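/- **Setting.** A network $\mathcal N$ in $\mathbb S^2$ with interior endpoint set $\mathcal P$ and boundary endpoint set $\mathcal Q$ is a finite collection of smooth regular curves $\gamma^1,\dots,\gamma^n:[0,1]\to\mathbb S^2$ without self-intersection ($\gamma^i$ injective), meeting each other only at endpoints, with pairwise different exterior unit tangents at each endpoint, such that $\mathcal P\cap\mathcal Q=\emptyset$ and $\mathcal P\cup\mathcal Q$ is the set of all endpoints; each $\gamma^i$ carries a unit normal field $\nu^i$ tangent to $\mathbb S^2$. A function on $\mathcal N$ is a tuple $u=(u^1,\dots,u^n)$ of functions on the curves; smoothness and Sobolev regularity are meant curve by curve; gradients, Laplacian and integrals are taken with respect to arc length, and $\partial u/\partial\tau$ is the outer derivative at the ends of the curves. For a set $A$ of endpoints let $V(A)=\bigoplus_{p\in A}\mathbb R^{j_p}$ ($j_p$ the number of curves ending at $p$) with the Euclidean inner product, $V_1(A)\subset V(A)$ the subspace of elements which at each $p\in A$ have the form $(X\cdot\nu^{j})_j$ for some $X\in T_p\mathbb S^2$, and $V_2(A)=V_1(A)^\perp$. Traces $u|_A$ and normal derivatives $\partial u/\partial\tau|_A$ are elements of $V(A)$.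 Let $d\in C^\infty(\mathcal N)$, $Lu=\Delta u+du$ and $\mathcal L(u,v)=\int_{\mathcal N}\nabla u\cdot\nabla v-duv$ (for stationary networks and $d\equiv1$ this is the second variation of length). Let $W^{1,2}_{0,1}(\mathcal N)=\{u\in W^{1,2}(\mathcal N):u=0\text{ on }\mathcal Q,\ u|_{\mathcal P}\in V_1(\mathcal P)\}$. The nullity $\mathrm{Nul}(\mathcal N)$ is the dimension of the null space $\{u\in W^{1,2}_{0,1}(\mathcal N):\mathcal L(u,v)=0\ \ \forall v\in W^{1,2}_{0,1}(\mathcal N)\}$. Let $\mathcal J_0^0(\mathcal N)$ be the space of smooth $u$ with $Lu=0$, $u=0$ on $\mathcal Q$, $u|_{\mathcal P}\in V_1(\mathcal P)$ and $\frac{\partial u}{\partial\tau}|_{\mathcal P}\in V_2(\mathcal P)$. For $\tilde{\mathcal Q}\subset\mathcal Q$ put $$D_\tau\mathcal J_0^0(\tilde{\mathcal Q})=\Big\{\tfrac{\partial u}{\partial\tau}\big|_{\tilde{\mathcal Q}}:u\in\mathcal J_0^0(\mathcal N)\Big\}\subset V(\tilde{\mathcal Q}),\qquad \mathcal I_0(\tilde{\mathcal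 Q})=\Big\{u\in\mathcal J_0^0(\mathcal N):\tfrac{\partial u}{\partial\tau}=0\text{ on }\tilde{\mathcal Q}\Big\}.$$ The Dirichlet-to-Neumann map $T:(D_\tau\mathcal J_0^0(\tilde{\mathcal Q}))^\perp\to(D_\tau\mathcal J_0^0(\tilde{\mathcal Q}))^\perp$ is the linear map $T(g)=\frac{\partial u}{\partial\tau}|_{\tilde{\mathcal Q}}$, where $u$ is any smooth solution of $Lu=0$ with $u|_{\mathcal P}\in V_1(\mathcal P)$, $\frac{\partial u}{\partial\tau}|_{\mathcal P}\in V_2(\mathcal P)$, $u=g$ on $\tilde{\mathcal Q}$, $u=0$ on $\mathcal Q\setminus\tilde{\mathcal Q}$ and $\frac{\partial u}{\partial\tau}|_{\tilde{\mathcal Q}}\perp D_\tau\mathcal J_0^0(\tilde{\mathcal Q})$. A partition of $\mathcal N$ consists of networks $\mathcal N_1,\dots,\mathcal N_l$, with endpoint sets $\mathcal P_i,\mathcal Q_i$, such that the collection of curves (with normals) of $\mathcal N$ is the disjoint union of those of the $\mathcal N_i$, together with decompositions $\mathcal P=\mathring{\mathcal P}\sqcup\overline{\mathcal P}$ and $\mathcal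 Q_i=\tilde{\mathcal Q}_i\sqcup\overline{\mathcal Q}_i$ such that $\mathring{\mathcal P}=\bigsqcup_i\mathcal P_i$, $\overline{\mathcal P}=\bigcup_i\tilde{\mathcal Q}_i$ and $\mathcal Q=\bigcup_i\overline{\mathcal Q}_i$. On $\mathcal N_i$ all notions are taken for the restriction of $d$. Identify $V(\overline{\mathcal P})=\bigoplus_iV(\tilde{\mathcal Q}_i)$ and put $$\overline V_1=\Big(\bigoplus_i(D_\tau\mathcal J_0^0(\tilde{\mathcal Q}_i))^\perp\Big)\cap V_1(\overline{\mathcal P}),\qquad F_2=\Big(\bigoplus_iD_\tau\mathcal J_0^0(\tilde{\mathcal Q}_i)\Big)\cap V_2(\overline{\mathcal P}).$$ Let $\hat T=\bigoplus_iT_i$ be the direct sum of the Dirichlet-to-Neumann maps of the $\mathcal N_i$ with respect to $\tilde{\mathcal Q}_i$, and let $\overline T:\overline V_1\to\overline V_1$ be $\hat T|_{\overline V_1}$ followed by the orthogonal projection onto $\overline V_1$; $\mathrm{Nul}(\overline T)=\dim\ker\overline T$. **Theorem.** Let $\mathcal N$ be a network in $\mathbb S^2$ with partition $\{\mathcal N_i\}_{i=1,\dots,l}$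 and let $d\in C^\infty(\mathcal N)$. Then the Dirichlet-to-Neumann maps $T_i$ are well defined, the null space of $\mathcal L$ on $W^{1,2}_{0,1}(\mathcal N)$ and the spaces $\mathcal I_0(\tilde{\mathcal Q}_i)$ are finite dimensional, and $$\mathrm{Nul}(\mathcal N)=\mathrm{Nul}(\overline T)+\dim F_2+\sum_{i=1}^l\dim\mathcal I_0(\tilde{\mathcal Q}_i).$$ -/

import Mathlib

open Set MeasureTheory
open scoped ContDiff unitInterval InnerProductSpace

noncomputable section

namespace SphereNetwork

/-- The ambient Euclidean space of the unit sphere `S²`. -/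
abbrev E3 : Type := EuclideanSpace ℝ (Fin 3)

/-! ### Functions on the closed parameter interval -/

/-- The extension of a function on `[0,1]` to the line (constant on both sides); it only serves to
apply one-dimensional calculus relative to `[0,1]`. -/
def ext {F : Type*} [TopologicalSpace F] (f : C(I, F)) : ℝ → F :=
  Set.IccExtend (zero_le_one (α := ℝ)) f

/-- `f` is smooth on `[0,1]`, up to the boundary. -/
def IsSmooth {F : Type*} [NormedAddCommGroup F] [NormedSpace ℝ F] (f : C(I, F)) : Prop :=
  ContDiffOn ℝ ∞ (ext f) (Icc 0 1)

/-- The derivative on `[0,1]`, one-sided at the end points. -/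
def der {F : Type*} [NormedAddCommGroup F] [NormedSpace ℝ F] (f : ℝ → F) : ℝ → F :=
  derivWithin f (Icc 0 1)

/-- The two ends of a parametrized curve: `false` is the parameter `0`, `true` is `1`. -/
def endParam : Bool → I
  | false => 0
  | true => 1

/-- The sign turning the unit tangent at an end into the outer unit normal of the curve. -/
def outSign : Bool → ℝ
  | false => -1
  | true => 1

/-- The speed `|γ'|`. -/
def speed (c : C(I, E3)) (t : ℝ) : ℝ := ‖der (ext c) t‖

/-- The exterior unit tangent vector `τ` at an end of a curve. -/
def outerTangent (c : C(I, E3)) (b : Bool) : E3 :=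
  outSign b • ((speed c (endParam b))⁻¹ • der (ext c) (endParam b))

/-- Derivative with respect to arc length along the curve `c`. -/
def arcDeriv (c : C(I, E3)) (f : ℝ → ℝ) (t : ℝ) : ℝ := der f t / speed c t

/-- The integral with respect to arc length along the curve `c`. -/
def arcIntegral (c : C(I, E3)) (f : ℝ → ℝ) : ℝ := ∫ t in (0 : ℝ)..1, f t * speed c t

/-! ### Networks -/

/-- An embedded network in the unit sphere: finitely many smooth regular curves `γ i`, each without
self-intersection, with chosen unit normal fields `ν i` (tangent to the sphere), interior end points
`P` and boundary end points `Q`. The number of curves is finite as soon as `ι` is. -/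
structure Network (ι : Type*) where
  γ : ι → C(I, E3)
  ν : ι → C(I, E3)
  P : Set E3
  Q : Set E3
  sphere : ∀ i t, ‖γ i t‖ = 1
  smooth : ∀ i, IsSmooth (γ i)
  regular : ∀ i, ∀ t : I, der (ext (γ i)) t ≠ 0
  injective : ∀ i, Function.Injective (γ i)
  normal_unit : ∀ i t, ‖ν i t‖ = 1
  normal_tangent : ∀ i t, ⟪γ i t, ν i t⟫_ℝ = 0
  normal_perp : ∀ i, ∀ t : I, ⟪der (ext (γ i)) t, ν i t⟫_ℝ = 0
  disjoint : Disjoint P Q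
  endpoints : P ∪ Q = ⋃ i, {γ i 0, γ i 1}
  embedded : ∀ i j, i ≠ j → ∀ s t, γ i s = γ j t → (s = 0 ∨ s = 1) ∧ (t = 0 ∨ t = 1)
  directions : ∀ i j b b', (i, b) ≠ (j, b') → γ i (endParam b) = γ j (endParam b') →
    outerTangent (γ i) b ≠ outerTangent (γ j) b'

variable {ι : Type*} [Fintype ι]

/-- The end point in the sphere of an end `(i, b)` of the network. -/
def Network.endpt (N : Network ι) (e : ι × Bool) : E3 := N.γ e.1 (endParam e.2)

/-- The normal vector of the curve at an end. -/
def Network.endNormal (N : Network ι) (e : ι × Bool) : E3 := N.ν e.1 (endParam e.2)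

/-- The ends of curves lying over the point set `A`. -/
abbrev Network.Ends (N : Network ι) (A : Set E3) : Type _ := {e : ι × Bool // N.endpt e ∈ A}

instance (N : Network ι) (A : Set E3) : Fintype (N.Ends A) := Fintype.ofFinite _

/-- `V(A)`: the direct sum over the points `p ∈ A` of `ℝ^m`, `m` the number of curves ending at `p`,
with the standard Euclidean inner product. -/
abbrev Network.V (N : Network ι) (A : Set E3) : Type _ := EuclideanSpace ℝ (N.Ends A)

/-- `V₁(A)`: the elements that at each `p ∈ A` are of the form `X · ν` for a tangent vector `X` of
the sphere at `p`. -/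
def Network.V₁ (N : Network ι) (A : Set E3) : Submodule ℝ (N.V A) where
  carrier := {v | ∀ p ∈ A, ∃ X : E3, ⟪p, X⟫_ℝ = 0 ∧
    ∀ e : N.Ends A, N.endpt e.1 = p → v e = ⟪X, N.endNormal e.1⟫_ℝ}
  zero_mem' := fun p _ => ⟨0, by simp, by simp⟩
  add_mem' := by
    intro v w hv hw p hp
    obtain ⟨X, hX, hX'⟩ := hv p hp
    obtain ⟨Y, hY, hY'⟩ := hw p hp
    refine ⟨X + Y, by simp [inner_add_right, hX, hY], fun e he => ?_⟩
    simp [inner_add_left, hX' e he, hY' e he]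
  smul_mem' := by
    intro c v hv p hp
    obtain ⟨X, hX, hX'⟩ := hv p hp
    refine ⟨c • X, by simp [inner_smul_right, hX], fun e he => ?_⟩
    simp [real_inner_smul_left, hX' e he]

/-- `V₂(A)`, the orthogonal complement of `V₁(A)`. -/
def Network.V₂ (N : Network ι) (A : Set E3) : Submodule ℝ (N.V A) := (N.V₁ A)ᗮ

/-- The values of a function on the network at the ends over `A`. -/
def Network.trace (N : Network ι) (A : Set E3) : (ι → C(I, ℝ)) →ₗ[ℝ] N.V A where
  toFun u := WithLp.toLp 2 fun e => u e.1.1 (endParam e.1.2)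
  map_add' u v := by ext e; simp
  map_smul' c u := by ext e; simp

/-! ### Smooth functions, the operator `L = Δ + d` and its null functions -/

lemma ext_add (f g : C(I, ℝ)) : ext (f + g) = ext f + ext g := rfl

lemma ext_smul (c : ℝ) (f : C(I, ℝ)) : ext (c • f) = c • ext f := rfl

lemma ext_zero : ext (0 : C(I, ℝ)) = 0 := rfl

lemma ext_continuous (f : C(I, ℝ)) : Continuous (ext f) := f.continuous.Icc_extend'

/-- `C^∞(N)`. -/
def smoothFun (ι : Type*) : Submodule ℝ (ι → C(I, ℝ)) where
  carrier := {u | ∀ i, IsSmooth (u i)}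
  zero_mem' := fun _ => (contDiffOn_const : ContDiffOn ℝ ∞ (fun _ : ℝ => (0 : ℝ)) (Icc 0 1))
  add_mem' := fun hu hv i => (hu i).add (hv i)
  smul_mem' := fun c _ hu i => (hu i).const_smul c

lemma uIcc01 : UniqueDiffOn ℝ (Icc (0 : ℝ) 1) := uniqueDiffOn_Icc zero_lt_one

lemma der_add {f g : ℝ → ℝ} (hf : ContDiffOn ℝ ∞ f (Icc 0 1)) (hg : ContDiffOn ℝ ∞ g (Icc 0 1))
    {t : ℝ} (ht : t ∈ Icc (0 : ℝ) 1) : der (f + g) t = der f t + der g t :=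
  derivWithin_add (hf.differentiableOn (by simp) t ht) (hg.differentiableOn (by simp) t ht)

lemma der_smul {f : ℝ → ℝ} (c : ℝ) (hf : ContDiffOn ℝ ∞ f (Icc 0 1))
    {t : ℝ} (ht : t ∈ Icc (0 : ℝ) 1) : der (c • f) t = c * der f t := by
  have := derivWithin_const_smul c (hf.differentiableOn (by simp) t ht)
  simpa [der] using this

lemma Network.speed_contDiffOn (N : Network ι) (i : ι) :
    ContDiffOn ℝ ∞ (speed (N.γ i)) (Icc 0 1) := by
  have h : ContDiffOn ℝ ∞ (der (ext (N.γ i))) (Icc 0 1) :=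
    (N.smooth i).derivWithin uIcc01 (by simp)
  exact h.norm ℝ fun t ht => N.regular i ⟨t, ht⟩

lemma Network.speed_ne_zero (N : Network ι) (i : ι) {t : ℝ} (ht : t ∈ Icc (0 : ℝ) 1) :
    speed (N.γ i) t ≠ 0 :=
  norm_ne_zero_iff.2 (N.regular i ⟨t, ht⟩)

lemma Network.arcDeriv_contDiffOn (N : Network ι) (i : ι) {f : ℝ → ℝ}
    (hf : ContDiffOn ℝ ∞ f (Icc 0 1)) : ContDiffOn ℝ ∞ (arcDeriv (N.γ i) f) (Icc 0 1) := by
  have h : ContDiffOn ℝ ∞ (der f) (Icc 0 1) := hf.derivWithin uIcc01 (by simp)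
  exact h.div (N.speed_contDiffOn i) fun t ht => N.speed_ne_zero i ht

/-- The Laplacian on the curve `c`: the second derivative with respect to arc length. -/
def lap (c : C(I, E3)) (f : ℝ → ℝ) : ℝ → ℝ := arcDeriv c (arcDeriv c f)

lemma Network.lap_add (N : Network ι) (i : ι) {f g : ℝ → ℝ} (hf : ContDiffOn ℝ ∞ f (Icc 0 1))
    (hg : ContDiffOn ℝ ∞ g (Icc 0 1)) {t : ℝ} (ht : t ∈ Icc (0 : ℝ) 1) :
    lap (N.γ i) (f + g) t = lap (N.γ i) f t + lap (N.γ i) g t := by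
  have h1 : EqOn (arcDeriv (N.γ i) (f + g)) (arcDeriv (N.γ i) f + arcDeriv (N.γ i) g) (Icc 0 1) :=
    fun s hs => by simp [arcDeriv, der_add hf hg hs, add_div]
  have h2 : der (arcDeriv (N.γ i) (f + g)) t = der (arcDeriv (N.γ i) f + arcDeriv (N.γ i) g) t :=
    derivWithin_congr h1 (h1 ht)
  simp only [lap]
  rw [arcDeriv, h2, der_add (N.arcDeriv_contDiffOn i hf) (N.arcDeriv_contDiffOn i hg) ht, add_div]
  rfl

lemma Network.lap_smul (N : Network ι) (i : ι) (c : ℝ) {f : ℝ → ℝ}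
    (hf : ContDiffOn ℝ ∞ f (Icc 0 1)) {t : ℝ} (ht : t ∈ Icc (0 : ℝ) 1) :
    lap (N.γ i) (c • f) t = c * lap (N.γ i) f t := by
  have h1 : EqOn (arcDeriv (N.γ i) (c • f)) (c • arcDeriv (N.γ i) f) (Icc 0 1) :=
    fun s hs => by simp [arcDeriv, der_smul c hf hs, mul_div_assoc]
  have h2 : der (arcDeriv (N.γ i) (c • f)) t = der (c • arcDeriv (N.γ i) f) t :=
    derivWithin_congr h1 (h1 ht)
  simp only [lap]
  rw [arcDeriv, h2, der_smul c (N.arcDeriv_contDiffOn i hf) ht, mul_div_assoc]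
  rfl

/-- The outer normal derivatives `∂u/∂τ` at the ends over `A`. -/
def Network.normalDeriv (N : Network ι) (A : Set E3) : smoothFun ι →ₗ[ℝ] N.V A where
  toFun u := WithLp.toLp 2 fun e =>
    outSign e.1.2 * arcDeriv (N.γ e.1.1) (ext (u.1 e.1.1)) (endParam e.1.2)
  map_add' u v := by
    ext e
    have := der_add (u.2 e.1.1) (v.2 e.1.1) (endParam e.1.2).2
    simp [arcDeriv, ext_add, this, add_div, mul_add]
  map_smul' c u := by
    ext e
    have := der_smul c (u.2 e.1.1) (endParam e.1.2).2
    simp only [arcDeriv, SetLike.val_smul, Pi.smul_apply, ext_smul, this, RingHom.id_apply,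
      PiLp.smul_apply, smul_eq_mul]
    ring

/-- `L u = Δ u + d u` vanishes on every curve. -/
def Network.IsLNull (N : Network ι) (d : ι → C(I, ℝ)) (u : smoothFun ι) : Prop :=
  ∀ i, ∀ t : I, lap (N.γ i) (ext (u.1 i)) t + d i t * u.1 i t = 0

/-- The compatible condition: at each `p ∈ P`, for all tangent vectors `X` of the sphere at `p`,
the sum over the ends at `p` of `(X · ν) ∂u/∂τ` vanishes. -/
def Network.Compatible (N : Network ι) (u : smoothFun ι) : Prop :=
  ∀ p ∈ N.P, ∀ X : E3, ⟪p, X⟫_ℝ = 0 →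
    ∑ e ∈ {e : N.Ends N.P | N.endpt e.1 = p}.toFinite.toFinset,
      ⟪X, N.endNormal e.1⟫_ℝ * N.normalDeriv N.P u e = 0

/-- The space `J₀⁰(N)`: the smooth functions `u` with `L u = 0`, vanishing on `Q`, with
`u ∈ V₁(P)` and satisfying the compatible condition (eigenfunctions of eigenvalue `0`). -/
def Network.nullFun (N : Network ι) (d : ι → C(I, ℝ)) : Submodule ℝ (smoothFun ι) where
  carrier := {u | N.IsLNull d u ∧ N.trace N.Q u.1 = 0 ∧ N.trace N.P u.1 ∈ N.V₁ N.P ∧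
    N.Compatible u}
  zero_mem' := by
    refine ⟨fun i t => ?_, by simp, by simp, fun p _ X _ => by simp⟩
    have := N.lap_smul i 0 ((0 : smoothFun ι).2 i) t.2
    rw [zero_smul, zero_mul] at this
    simp only [ZeroMemClass.coe_zero, Pi.zero_apply, ext_zero] at this ⊢
    simp [this]
  add_mem' := by
    rintro u v ⟨hu, hu1, hu2, hu3⟩ ⟨hv, hv1, hv2, hv3⟩
    refine ⟨fun i t => ?_, by simp [hu1, hv1], ?_, fun p hp X hX => ?_⟩
    · have := N.lap_add i (u.2 i) (v.2 i) t.2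
      simp only [Submodule.coe_add, Pi.add_apply, ext_add, this, ContinuousMap.add_apply]
      linear_combination hu i t + hv i t
    · rw [Submodule.coe_add, map_add]
      exact add_mem hu2 hv2
    · have h1 := hu3 p hp X hX
      have h2 := hv3 p hp X hX
      simp only [map_add, PiLp.add_apply, mul_add, Finset.sum_add_distrib, h1, h2, add_zero]
  smul_mem' := by
    rintro c u ⟨hu, hu1, hu2, hu3⟩
    refine ⟨fun i t => ?_, by simp [hu1], ?_, fun p hp X hX => ?_⟩
    · have := N.lap_smul i c (u.2 i) t.2
      simp only [SetLike.val_smul, Pi.smul_apply, ext_smul, this, ContinuousMap.smul_apply,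
        smul_eq_mul]
      linear_combination c * hu i t
    · rw [SetLike.val_smul, map_smul]
      exact Submodule.smul_mem _ _ hu2
    · have h1 := hu3 p hp X hX
      simp only [map_smul, PiLp.smul_apply, smul_eq_mul, mul_left_comm _ c, ← Finset.mul_sum, h1,
        mul_zero]

/-- `D_τ J₀⁰(A)`: the Neumann data on `A` of the null functions. -/
def Network.neumannNull (N : Network ι) (d : ι → C(I, ℝ)) (A : Set E3) : Submodule ℝ (N.V A) :=
  (N.nullFun d).map (N.normalDeriv A)

/-- `I₀(A)`: the null functions whose Neumann data vanish on `A`. -/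
def Network.I₀ (N : Network ι) (d : ι → C(I, ℝ)) (A : Set E3) : Submodule ℝ (smoothFun ι) :=
  N.nullFun d ⊓ LinearMap.ker (N.normalDeriv A)

/-! ### The Dirichlet-to-Neumann map -/

/-- `u` is a smooth solution of `L u = 0` with `u ∈ V₁(P)`, the compatible condition on `P`, the
values `g` on `A`, zero on `Q \ A`, and with `∂u/∂τ` orthogonal to `D_τ J₀⁰(A)` on `A`. -/
def Network.IsLExtension (N : Network ι) (d : ι → C(I, ℝ)) (A : Set E3) (g : N.V A)
    (u : smoothFun ι) : Prop :=
  N.IsLNull d u ∧ N.trace N.P u.1 ∈ N.V₁ N.P ∧ N.Compatible u ∧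
    N.trace A u.1 = g ∧ N.trace (N.Q \ A) u.1 = 0 ∧ N.normalDeriv A u ∈ (N.neumannNull d A)ᗮ

/-- `T` is the Dirichlet-to-Neumann map with respect to `A ⊆ Q`: each `g` orthogonal to `D_τ J₀⁰(A)`
has an extension as above, and `T g = ∂u/∂τ` on `A` for every such extension `u`. -/
def Network.IsDtN (N : Network ι) (d : ι → C(I, ℝ)) (A : Set E3)
    (T : (N.neumannNull d A)ᗮ →ₗ[ℝ] (N.neumannNull d A)ᗮ) : Prop :=
  ∀ g : (N.neumannNull d A)ᗮ, (∃ u, N.IsLExtension d A g u) ∧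
    ∀ u, N.IsLExtension d A g u → (T g : N.V A) = N.normalDeriv A u

open Classical in
/-- The Dirichlet-to-Neumann map with respect to `A ⊆ Q`. -/
def Network.dtN (N : Network ι) (d : ι → C(I, ℝ)) (A : Set E3) :
    (N.neumannNull d A)ᗮ →ₗ[ℝ] (N.neumannNull d A)ᗮ :=
  if h : ∃ T, N.IsDtN d A T then h.choose else 0

/-! ### Sobolev functions, the index form and the nullity -/

/-- `g` is a weak derivative of `f` on the open interval `(0,1)`. -/
def IsWeakDeriv (f g : ℝ → ℝ) : Prop :=
  ∀ φ : ℝ → ℝ, ContDiff ℝ ∞ φ → HasCompactSupport φ → tsupport φ ⊆ Ioo 0 1 →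
    ∫ t in (0 : ℝ)..1, f t * deriv φ t = -∫ t in (0 : ℝ)..1, g t * φ t

/-- Membership in `W^{1,2}(0,1)`. A Sobolev function on an interval is represented by its continuous
representative, so that its traces are its values at `0` and `1`. -/
def MemW12 (f : C(I, ℝ)) : Prop :=
  ∃ g : ℝ → ℝ, MemLp g 2 (volume.restrict (Ioc 0 1)) ∧ IsWeakDeriv (ext f) g

open Classical in
/-- The weak derivative (unique almost everywhere on `(0,1)`). -/
def weakDeriv (f : C(I, ℝ)) : ℝ → ℝ := if h : MemW12 f then h.choose else 0

/-- The bilinear form `∫_N ∇u · ∇v - d u v`, with gradients and integrals taken with respect to arc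
length. -/
def Network.indexForm (N : Network ι) (d u v : ι → C(I, ℝ)) : ℝ :=
  ∑ i, arcIntegral (N.γ i) fun t =>
    (weakDeriv (u i) t / speed (N.γ i) t) * (weakDeriv (v i) t / speed (N.γ i) t)
      - ext (d i) t * ext (u i) t * ext (v i) t

lemma weakDeriv_memLp {f : C(I, ℝ)} (hf : MemW12 f) :
    MemLp (weakDeriv f) 2 (volume.restrict (Ioc 0 1)) := by
  rw [weakDeriv, dif_pos hf]
  exact hf.choose_spec.1

lemma weakDeriv_spec {f : C(I, ℝ)} (hf : MemW12 f) : IsWeakDeriv (ext f) (weakDeriv f) := by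
  rw [weakDeriv, dif_pos hf]
  exact hf.choose_spec.2

lemma intervalIntegrable_of_memLp {g : ℝ → ℝ} (hg : MemLp g 2 (volume.restrict (Ioc 0 1))) :
    IntervalIntegrable g volume 0 1 :=
  (intervalIntegrable_iff_integrableOn_Ioc_of_le zero_le_one).2
    (hg.integrable (by norm_num))

lemma isWeakDeriv_unique {f g h : ℝ → ℝ} (hg : IsWeakDeriv f g) (hh : IsWeakDeriv f h)
    (hg2 : MemLp g 2 (volume.restrict (Ioc 0 1))) (hh2 : MemLp h 2 (volume.restrict (Ioc 0 1))) :
    g =ᵐ[volume.restrict (Ioc 0 1)] h := by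
  have hgi := intervalIntegrable_of_memLp hg2
  have hhi := intervalIntegrable_of_memLp hh2
  have hI : IntegrableOn (fun t => g t - h t) (Ioc 0 1) :=
    (intervalIntegrable_iff_integrableOn_Ioc_of_le zero_le_one).1 (hgi.sub hhi)
  have key : ∀ᵐ t ∂(volume : Measure ℝ), t ∈ Ioo (0 : ℝ) 1 → g t - h t = 0 := by
    refine isOpen_Ioo.ae_eq_zero_of_integral_contDiff_smul_eq_zero
      (hI.mono_set Ioo_subset_Ioc_self).locallyIntegrableOn ?_
    intro φ hφ hc hs
    have h1 := hg φ hφ hc hs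
    have h2 := hh φ hφ hc hs
    have hsupp : Function.support (fun t => φ t • (g t - h t)) ⊆ Ioc 0 1 := by
      intro t ht
      refine Ioo_subset_Ioc_self (hs (subset_tsupport _ ?_))
      simp only [Function.mem_support] at ht ⊢
      exact fun h0 => ht (by simp [h0])
    rw [← intervalIntegral.integral_eq_integral_of_support_subset hsupp]
    have e1 := hgi.mul_continuousOn hφ.continuous.continuousOn
    have e2 := hhi.mul_continuousOn hφ.continuous.continuousOn
    calc ∫ t in (0 : ℝ)..1, φ t • (g t - h t)
        = ∫ t in (0 : ℝ)..1, (g t * φ t - h t * φ t) := by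
          congr 1; ext t; simp only [smul_eq_mul]; ring
      _ = 0 := by
          rw [intervalIntegral.integral_sub e1 e2]
          linarith
  have : ∀ᵐ t ∂(volume.restrict (Ioo (0 : ℝ) 1)), g t - h t = 0 :=
    (ae_restrict_iff' measurableSet_Ioo).2 key
  rw [← restrict_Ioo_eq_restrict_Ioc]
  filter_upwards [this] with t ht using sub_eq_zero.1 ht

lemma IsWeakDeriv.add {f₁ f₂ : C(I, ℝ)} {g₁ g₂ : ℝ → ℝ} (h₁ : IsWeakDeriv (ext f₁) g₁)
    (h₂ : IsWeakDeriv (ext f₂) g₂) (m₁ : MemLp g₁ 2 (volume.restrict (Ioc 0 1)))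
    (m₂ : MemLp g₂ 2 (volume.restrict (Ioc 0 1))) : IsWeakDeriv (ext (f₁ + f₂)) (g₁ + g₂) := by
  intro φ hφ hc hs
  have hd : Continuous (deriv φ) := hφ.continuous_deriv (by simp)
  have a := intervalIntegral.integral_add (μ := volume) (a := 0) (b := 1)
    (f := fun t => ext f₁ t * deriv φ t) (g := fun t => ext f₂ t * deriv φ t)
    (((ext_continuous f₁).mul hd).intervalIntegrable 0 1)
    (((ext_continuous f₂).mul hd).intervalIntegrable 0 1)
  have b := intervalIntegral.integral_add (μ := volume) (a := 0) (b := 1)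
    ((intervalIntegrable_of_memLp m₁).mul_continuousOn hφ.continuous.continuousOn)
    ((intervalIntegrable_of_memLp m₂).mul_continuousOn hφ.continuous.continuousOn)
  simp only [ext_add, Pi.add_apply, add_mul]
  rw [a, b, h₁ φ hφ hc hs, h₂ φ hφ hc hs]
  ring

lemma IsWeakDeriv.smul {f : C(I, ℝ)} {g : ℝ → ℝ} (c : ℝ) (h : IsWeakDeriv (ext f) g) :
    IsWeakDeriv (ext (c • f)) (c • g) := by
  intro φ hφ hc hs
  simp only [ext_smul, Pi.smul_apply, smul_eq_mul, mul_assoc, intervalIntegral.integral_const_mul,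
    h φ hφ hc hs]
  ring

/-- `W^{1,2}(N)`. -/
def sobolev (ι : Type*) : Submodule ℝ (ι → C(I, ℝ)) where
  carrier := {u | ∀ i, MemW12 (u i)}
  zero_mem' := fun i => ⟨0, MemLp.zero, fun φ _ _ _ => by simp [ext_zero]⟩
  add_mem' := by
    intro u v hu hv i
    obtain ⟨g, hg, hg'⟩ := hu i
    obtain ⟨h, hh, hh'⟩ := hv i
    exact ⟨g + h, hg.add hh, hg'.add hh' hg hh⟩
  smul_mem' := by
    intro c u hu i
    obtain ⟨g, hg, hg'⟩ := hu i
    exact ⟨c • g, hg.const_smul c, hg'.smul c⟩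

/-- `W^{1,2}_{0,1}(N)`: Sobolev functions vanishing on `Q` with trace on `P` in `V₁(P)`. -/
def Network.sobolev₀₁ (N : Network ι) : Submodule ℝ (ι → C(I, ℝ)) :=
  sobolev ι ⊓ LinearMap.ker (N.trace N.Q) ⊓ (N.V₁ N.P).comap (N.trace N.P)

lemma weakDeriv_add {f₁ f₂ : C(I, ℝ)} (h₁ : MemW12 f₁) (h₂ : MemW12 f₂) :
    weakDeriv (f₁ + f₂) =ᵐ[volume.restrict (Ioc 0 1)] weakDeriv f₁ + weakDeriv f₂ := by
  have m := (weakDeriv_memLp h₁).add (weakDeriv_memLp h₂)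
  have w := (weakDeriv_spec h₁).add (weakDeriv_spec h₂) (weakDeriv_memLp h₁) (weakDeriv_memLp h₂)
  have h : MemW12 (f₁ + f₂) := ⟨_, m, w⟩
  exact isWeakDeriv_unique (weakDeriv_spec h) w (weakDeriv_memLp h) m

lemma weakDeriv_smul {f : C(I, ℝ)} (c : ℝ) (h₁ : MemW12 f) :
    weakDeriv (c • f) =ᵐ[volume.restrict (Ioc 0 1)] c • weakDeriv f := by
  have m := (weakDeriv_memLp h₁).const_smul c
  have w := (weakDeriv_spec h₁).smul c
  have h : MemW12 (c • f) := ⟨_, m, w⟩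
  exact isWeakDeriv_unique (weakDeriv_spec h) w (weakDeriv_memLp h) m

lemma Network.indexForm_integrable (N : Network ι) (d : ι → C(I, ℝ)) {u v : ι → C(I, ℝ)} (i : ι)
    (hu : MemW12 (u i)) (hv : MemW12 (v i)) :
    IntervalIntegrable (fun t =>
      ((weakDeriv (u i) t / speed (N.γ i) t) * (weakDeriv (v i) t / speed (N.γ i) t)
        - ext (d i) t * ext (u i) t * ext (v i) t) * speed (N.γ i) t) volume 0 1 := by
  have hI : uIcc (0 : ℝ) 1 = Icc 0 1 := uIcc_of_le zero_le_one
  have hs : ContinuousOn (speed (N.γ i)) (uIcc 0 1) := by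
    rw [hI]; exact (N.speed_contDiffOn i).continuousOn
  have hs0 : ∀ t ∈ uIcc (0 : ℝ) 1, speed (N.γ i) t ≠ 0 := fun t ht => by
    rw [hI] at ht; exact N.speed_ne_zero i ht
  have h1 : IntervalIntegrable (fun t => weakDeriv (u i) t * weakDeriv (v i) t) volume 0 1 :=
    (intervalIntegrable_iff_integrableOn_Ioc_of_le zero_le_one).2
      ((weakDeriv_memLp hu).integrable_mul (weakDeriv_memLp hv))
  have h2 := h1.mul_continuousOn ((hs.mul hs).inv₀ fun t ht => mul_ne_zero (hs0 t ht) (hs0 t ht))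
  have h3 : IntervalIntegrable (fun t => ext (d i) t * ext (u i) t * ext (v i) t) volume 0 1 :=
    (((ext_continuous (d i)).mul (ext_continuous (u i))).mul
      (ext_continuous (v i))).intervalIntegrable 0 1
  refine IntervalIntegrable.mul_continuousOn ?_ hs
  convert h2.sub h3 using 1
  ext t
  simp only [Pi.inv_apply, Pi.mul_apply, div_eq_mul_inv, mul_inv]
  ring

lemma Network.indexForm_add_left (N : Network ι) (d : ι → C(I, ℝ)) {u w v : ι → C(I, ℝ)}
    (hu : u ∈ sobolev ι) (hw : w ∈ sobolev ι) (hv : v ∈ sobolev ι) :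
    N.indexForm d (u + w) v = N.indexForm d u v + N.indexForm d w v := by
  simp only [indexForm, arcIntegral, ← Finset.sum_add_distrib]
  refine Finset.sum_congr rfl fun i _ => ?_
  rw [← intervalIntegral.integral_add (N.indexForm_integrable d i (hu i) (hv i))
    (N.indexForm_integrable d i (hw i) (hv i))]
  refine intervalIntegral.integral_congr_ae_restrict ?_
  rw [uIoc_of_le zero_le_one]
  filter_upwards [weakDeriv_add (hu i) (hw i)] with t ht
  simp only [Pi.add_apply, ext_add] at ht ⊢
  rw [ht]
  ring

lemma Network.indexForm_smul_left (N : Network ι) (d : ι → C(I, ℝ)) (c : ℝ) {u v : ι → C(I, ℝ)}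
    (hu : u ∈ sobolev ι) : N.indexForm d (c • u) v = c * N.indexForm d u v := by
  simp only [indexForm, arcIntegral, Finset.mul_sum, ← intervalIntegral.integral_const_mul]
  refine Finset.sum_congr rfl fun i _ => ?_
  refine intervalIntegral.integral_congr_ae_restrict ?_
  rw [uIoc_of_le zero_le_one]
  filter_upwards [weakDeriv_smul c (hu i)] with t ht
  simp only [Pi.smul_apply, ext_smul, smul_eq_mul] at ht ⊢
  rw [ht]
  ring

/-- The null space of the index form on `W^{1,2}_{0,1}(N)`. -/
def Network.nullSpace (N : Network ι) (d : ι → C(I, ℝ)) : Submodule ℝ (ι → C(I, ℝ)) where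
  carrier := {u | u ∈ N.sobolev₀₁ ∧ ∀ v ∈ N.sobolev₀₁, N.indexForm d u v = 0}
  zero_mem' := by
    refine ⟨zero_mem _, fun v _ => ?_⟩
    have := N.indexForm_smul_left d 0 (v := v) (zero_mem (sobolev ι))
    simpa using this
  add_mem' := by
    rintro u w ⟨hu, hu'⟩ ⟨hw, hw'⟩
    refine ⟨add_mem hu hw, fun v hv => ?_⟩
    rw [N.indexForm_add_left d hu.1.1 hw.1.1 hv.1.1, hu' v hv, hw' v hv, add_zero]
  smul_mem' := by
    rintro c u ⟨hu, hu'⟩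
    refine ⟨Submodule.smul_mem _ c hu, fun v hv => ?_⟩
    rw [N.indexForm_smul_left d c hu.1.1, hu' v hv, mul_zero]

/-- The nullity `Nul(N)` (for the operator `L = Δ + d`). -/
def Network.nullity (N : Network ι) (d : ι → C(I, ℝ)) : ℕ := Module.finrank ℝ (N.nullSpace d)

/-! ### Partitions -/

/-- A partition of `N` into `l` subnetworks: each curve (with its normal field) is assigned to one
subnetwork `sub k`; `Pin` are the interior end points of `N` that remain interior, `Pcut` are the cut
points, `Qcut k` and `Qout k` are the boundary end points of `sub k` at cut points and at boundary
points of `N`. -/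
structure Partition (N : Network ι) (l : ℕ) where
  block : ι → Fin l
  sub : ∀ k, Network {j : ι // block j = k}
  γ_eq : ∀ k j, (sub k).γ j = N.γ j.1
  ν_eq : ∀ k j, (sub k).ν j = N.ν j.1
  Pin : Set E3
  Pcut : Set E3
  Qcut : Fin l → Set E3
  Qout : Fin l → Set E3
  P_eq : N.P = Pin ∪ Pcut
  P_disj : Disjoint Pin Pcut
  Qsub_eq : ∀ k, (sub k).Q = Qcut k ∪ Qout k
  Qsub_disj : ∀ k, Disjoint (Qcut k) (Qout k)
  Pin_eq : Pin = ⋃ k, (sub k).P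
  Pin_disj : Pairwise fun k m => Disjoint (sub k).P (sub m).P
  Pcut_eq : Pcut = ⋃ k, Qcut k
  Q_eq : N.Q = ⋃ k, Qout k

namespace Partition

variable {N : Network ι} {l : ℕ} (S : Partition N l)

/-- The restriction of a function on `N` to the subnetwork `k`. -/
def restr (u : ι → C(I, ℝ)) (k : Fin l) : {j : ι // S.block j = k} → C(I, ℝ) := fun j => u j.1

lemma endpt_sub (k : Fin l) (j : {j : ι // S.block j = k}) (b : Bool) :
    (S.sub k).endpt (j, b) = N.endpt (j.1, b) := by
  simp [Network.endpt, S.γ_eq]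

lemma mem_Qcut {j : ι} {b : Bool} (h : N.endpt (j, b) ∈ S.Pcut) :
    N.endpt (j, b) ∈ S.Qcut (S.block j) := by
  have h0 : N.endpt (j, b) ∈ (S.sub (S.block j)).P ∪ (S.sub (S.block j)).Q := by
    rw [(S.sub (S.block j)).endpoints]
    refine mem_iUnion.2 ⟨⟨j, rfl⟩, ?_⟩
    rw [S.γ_eq]
    cases b <;> simp [Network.endpt, endParam]
  rcases h0 with h0 | h0
  · refine absurd h (disjoint_left.1 S.P_disj ?_)
    rw [S.Pin_eq]
    exact mem_iUnion.2 ⟨_, h0⟩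
  · rw [S.Qsub_eq] at h0
    rcases h0 with h0 | h0
    · exact h0
    · have h1 : N.endpt (j, b) ∈ N.Q := by
        rw [S.Q_eq]
        exact mem_iUnion.2 ⟨_, h0⟩
      have h2 : N.endpt (j, b) ∈ N.P := by
        rw [S.P_eq]
        exact Or.inr h
      exact absurd h1 (disjoint_left.1 N.disjoint h2)

lemma mem_Pcut {k : Fin l} {p : E3} (h : p ∈ S.Qcut k) : p ∈ S.Pcut := by
  rw [S.Pcut_eq]
  exact mem_iUnion.2 ⟨k, h⟩

/-- The identification of `V(Pcut)` with the direct sum of the spaces `V(Qcut k)` of the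
subnetworks: both consist of one real number for each end of a curve at a cut point. -/
def split : N.V S.Pcut ≃ₗ[ℝ] (∀ k, (S.sub k).V (S.Qcut k)) where
  toFun g := fun k => WithLp.toLp 2 fun e =>
    g ⟨(e.1.1.1, e.1.2), S.mem_Pcut (k := k) (by rw [← S.endpt_sub]; exact e.2)⟩
  invFun h := WithLp.toLp 2 fun e =>
    h (S.block e.1.1) ⟨(⟨e.1.1, rfl⟩, e.1.2), by rw [S.endpt_sub]; exact S.mem_Qcut e.2⟩
  map_add' g h := by ext k e; simp
  map_smul' c g := by ext k e; simp
  left_inv g := by ext e; simp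
  right_inv h := by
    ext k ⟨⟨⟨j, rfl⟩, b⟩, he⟩
    simp

/-- The direct sum of subspaces of the `V(Qcut k)`, as a subspace of `V(Pcut)`. -/
def sum (W : ∀ k, Submodule ℝ ((S.sub k).V (S.Qcut k))) : Submodule ℝ (N.V S.Pcut) :=
  (Submodule.pi univ W).comap S.split.toLinearMap

/-- `D_τ J₀⁰(Qcut k)` of the `k`-th subnetwork. -/
def D (d : ι → C(I, ℝ)) (k : Fin l) : Submodule ℝ ((S.sub k).V (S.Qcut k)) :=
  (S.sub k).neumannNull (S.restr d k) (S.Qcut k)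

/-- The space `(⨁ (D_τ J₀⁰(Qcut k))ᗮ) ∩ V₁(Pcut)`. -/
def V₁bar (d : ι → C(I, ℝ)) : Submodule ℝ (N.V S.Pcut) :=
  S.sum (fun k => (S.D d k)ᗮ) ⊓ N.V₁ S.Pcut

/-- The space `F₂ = (⨁ D_τ J₀⁰(Qcut k)) ∩ V₂(Pcut)`. -/
def F₂ (d : ι → C(I, ℝ)) : Submodule ℝ (N.V S.Pcut) :=
  S.sum (S.D d) ⊓ N.V₂ S.Pcut

/-- The `k`-th component of an element of a direct sum of subspaces. -/
def component (W : ∀ k, Submodule ℝ ((S.sub k).V (S.Qcut k))) (k : Fin l) : S.sum W →ₗ[ℝ] W k :=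
  (LinearMap.proj k ∘ₗ S.split.toLinearMap ∘ₗ (S.sum W).subtype).codRestrict (W k)
    fun g => g.2 k (mem_univ k)

/-- The direct sum of the Dirichlet-to-Neumann maps of the subnetworks with respect to `Qcut k`. -/
def That (d : ι → C(I, ℝ)) :
    S.sum (fun k => (S.D d k)ᗮ) →ₗ[ℝ] S.sum (fun k => (S.D d k)ᗮ) :=
  (S.split.symm.toLinearMap ∘ₗ LinearMap.pi fun k =>
    (S.D d k)ᗮ.subtype ∘ₗ (S.sub k).dtN (S.restr d k) (S.Qcut k) ∘ₗ
      S.component (fun k => (S.D d k)ᗮ) k).codRestrict _ (by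
    intro g
    refine Submodule.mem_comap.2 fun k _ => ?_
    simp only [LinearMap.comp_apply, LinearEquiv.coe_coe, LinearEquiv.apply_symm_apply,
      LinearMap.pi_apply]
    exact Subtype.property _)

/-- The Dirichlet-to-Neumann map of the partition: `That` on `V₁bar`, followed by the orthogonal
projection to `V₁bar`. -/
def Tbar (d : ι → C(I, ℝ)) : S.V₁bar d →ₗ[ℝ] S.V₁bar d :=
  (S.V₁bar d).orthogonalProjectionOnto.toLinearMap ∘ₗ (S.sum fun k => (S.D d k)ᗮ).subtype ∘ₗ
    S.That d ∘ₗ Submodule.inclusion inf_le_left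

end Partition

end SphereNetwork

end

/-!
The nullity formula is a dimension count for smooth null functions, once the analysis on each curve
has been reduced to a linear system of ordinary differential equations.

**Analysis.** On a curve with speed `s`, the function `u` and its arc length derivative `p` satisfy
`u' = s p`, `p' = -s d u` when `L u = 0`. Solutions exist on the whole curve with arbitrary Cauchy
data at either end (`exists_isLinearSol`), are smooth, and are determined by these data; hence the
solution space is finite dimensional. By the du Bois-Reymond lemma
(`IsWeakDeriv.ae_const_of_zero`) a function in the null space of the index form solves this system,
and the natural boundary condition is the compatible condition. Thus the null space is the space
`J₀⁰` of null functions (`Network.nullSpace_eq_map`).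

**Fredholm alternative.** All boundary conditions are expressed in the Euclidean space of data at
the ends of curves: with `K` the subspace `Network.admissible`, a solution is a null function if and
only if its values lie in `K` and its normal derivatives in `Kᗮ`. Green's formula makes the space of
Cauchy data of solutions isotropic, and solvability from either end of each curve makes it maximal
isotropic (`Network.exists_isLNull_of_pairing`). Dirichlet data orthogonal to the Neumann data of the
null functions are therefore attained modulo `K` (`Network.exists_isLNull_endVal_sub_mem`). This
gives the Dirichlet-to-Neumann maps (`Network.isDtN_dtN`).

**Dimension count.** A null function of the network is a family of solutions on the parts subject to
transmission conditions at the cut points: values in `V₁`, normal derivatives in `V₂`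
(`Partition.mem_nullFun_iff`). Given values `g` at the cut points, the normal derivatives are `T̂ g`
up to an element of the direct sum `D` of the spaces `D_τ J₀⁰`. Since the orthogonal complement of
`Dᗮ ⊓ V₁` is `D ⊔ V₂`, the values that occur are precisely the elements of the kernel of `T̄`
(`Partition.map_traceCut_nullFun`). The normal derivatives of the null functions with zero values at
the cut points form `F₂` (`Partition.map_normalDeriv_nullFun_inf`), and those with zero Cauchy data
there are the families of elements of the spaces `I₀` (`Partition.finrank_nullFun_inf_inf`). The
rank-nullity theorem, applied twice, gives the formula.
-/

noncomputable section

set_option linter.unusedSectionVars false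

namespace SphereNetwork

/-! ### Weak derivatives on the unit interval -/

/-- The **du Bois-Reymond lemma** on `(0,1)`: a function with vanishing weak derivative is constant
almost everywhere. -/
lemma IsWeakDeriv.ae_const_of_zero {f : ℝ → ℝ} (hf : IntervalIntegrable f volume 0 1)
    (h : IsWeakDeriv f 0) : ∃ c, ∀ᵐ t ∂(volume.restrict (Ioc (0 : ℝ) 1)), f t = c := by
  -- a test function of integral one
  let ψ₀ : ContDiffBump (1 / 2 : ℝ) := ⟨1 / 8, 1 / 4, by norm_num, by norm_num⟩
  let ψ : ℝ → ℝ := ψ₀.normed volume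
  have hψ : ContDiff ℝ ∞ ψ := ψ₀.contDiff_normed
  have hψc : HasCompactSupport ψ := ψ₀.hasCompactSupport_normed
  have hψs : tsupport ψ ⊆ Ioo 0 1 := by
    rw [show tsupport ψ = _ from ψ₀.tsupport_normed_eq, Real.closedBall_eq_Icc]
    exact Icc_subset_Ioo (by norm_num) (by norm_num)
  have hψi : ∫ t, ψ t = 1 := ψ₀.integral_normed
  have int01 : ∀ g : ℝ → ℝ, tsupport g ⊆ Ioo 0 1 → ∫ t in (0 : ℝ)..1, g t = ∫ t, g t :=
    fun g hg => intervalIntegral.integral_eq_integral_of_support_subset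
      ((subset_tsupport g).trans (hg.trans Ioo_subset_Ioc_self))
  refine ⟨∫ t in (0 : ℝ)..1, f t * ψ t, ?_⟩
  set c := ∫ t in (0 : ℝ)..1, f t * ψ t with hc
  rw [← restrict_Ioo_eq_restrict_Ioc, ae_restrict_iff' measurableSet_Ioo]
  have hI := (intervalIntegrable_iff_integrableOn_Ioc_of_le zero_le_one).1
    (hf.sub (intervalIntegrable_const (c := c)))
  have key : ∀ᵐ t ∂(volume : Measure ℝ), t ∈ Ioo (0 : ℝ) 1 → f t - c = 0 := by
    refine isOpen_Ioo.ae_eq_zero_of_integral_contDiff_smul_eq_zero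
      (hI.mono_set Ioo_subset_Ioc_self).locallyIntegrableOn ?_
    intro η hη hηc hηs
    have hsupp : Function.support (fun t => η t • (f t - c)) ⊆ Ioc 0 1 := by
      intro t ht
      refine Ioo_subset_Ioc_self (hηs (subset_tsupport _ ?_))
      simp only [Function.mem_support] at ht ⊢
      exact fun h0 => ht (by simp [h0])
    rw [← intervalIntegral.integral_eq_integral_of_support_subset hsupp]
    set m := ∫ t in (0 : ℝ)..1, η t with hm
    -- `η - m ψ` has integral zero, hence is the derivative of a test function
    let k : ℝ → ℝ := fun t => η t - m * ψ t
    have hk : ContDiff ℝ ∞ k := hη.sub (contDiff_const.mul hψ)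
    let φ : ℝ → ℝ := fun t => ∫ s in (0 : ℝ)..t, k s
    have hφd : ∀ t, HasDerivAt φ (k t) t := fun t =>
      intervalIntegral.integral_hasDerivAt_right (hk.continuous.intervalIntegrable _ _)
        hk.continuous.stronglyMeasurable.stronglyMeasurableAtFilter hk.continuous.continuousAt
    have hφ' : deriv φ = k := funext fun t => (hφd t).deriv
    have hφ : ContDiff ℝ ∞ φ :=
      contDiff_infty_iff_deriv.2 ⟨fun t => (hφd t).differentiableAt, hφ' ▸ hk⟩
    have hK : IsCompact (tsupport η ∪ tsupport ψ) := hηc.isCompact.union hψc.isCompact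
    have hKs : tsupport η ∪ tsupport ψ ⊆ Ioo 0 1 := union_subset hηs hψs
    obtain ⟨a, b, ha, hb, hab⟩ : ∃ a b : ℝ, 0 < a ∧ b < 1 ∧
        tsupport η ∪ tsupport ψ ⊆ Icc a b := by
      have hne : (tsupport η ∪ tsupport ψ).Nonempty := by
        refine ⟨1 / 2, Or.inr ?_⟩
        rw [show tsupport ψ = _ from ψ₀.tsupport_normed_eq, Real.closedBall_eq_Icc]
        exact ⟨by norm_num, by norm_num⟩
      obtain ⟨a, ha, ha'⟩ := hK.exists_isLeast hne
      obtain ⟨b, hb, hb'⟩ := hK.exists_isGreatest hne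
      exact ⟨a, b, (hKs ha).1, (hKs hb).2, fun t ht => ⟨ha' ht, hb' ht⟩⟩
    have hk0 : ∀ t, t ∉ Icc a b → k t = 0 := by
      intro t ht
      have h1 : η t = 0 := image_eq_zero_of_notMem_tsupport fun h' => ht (hab (Or.inl h'))
      have h2 : ψ t = 0 := image_eq_zero_of_notMem_tsupport fun h' => ht (hab (Or.inr h'))
      simp [k, h1, h2]
    have hk01 : ∫ t in (0 : ℝ)..1, k t = 0 := by
      have i3 : IntervalIntegrable (fun t => m * ψ t) volume 0 1 :=
        (continuous_const.mul hψ.continuous).intervalIntegrable _ _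
      rw [intervalIntegral.integral_sub (hη.continuous.intervalIntegrable _ _) i3,
        intervalIntegral.integral_const_mul, int01 ψ hψs, hψi, ← hm]
      ring
    have hφ0 : ∀ t, t ∉ Icc a b → φ t = 0 := by
      intro t ht
      rcases lt_or_ge t a with h' | h'
      · refine intervalIntegral.integral_zero_ae (Filter.Eventually.of_forall fun s hs => hk0 s ?_)
        rintro ⟨h1, -⟩
        rcases le_total 0 t with h0 | h0
        · rw [uIoc_of_le h0] at hs; linarith [hs.2]
        · rw [uIoc_of_ge h0] at hs; linarith [hs.2]
      · have h'' : b < t := by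
          by_contra h2
          exact ht ⟨h', not_lt.1 h2⟩
        have hrest : ∫ s in t..1, k s = 0 := by
          refine intervalIntegral.integral_zero_ae
            (Filter.Eventually.of_forall fun s hs => hk0 s ?_)
          rintro ⟨-, h1⟩
          rcases le_total t 1 with h0 | h0
          · rw [uIoc_of_le h0] at hs; linarith [hs.1]
          · rw [uIoc_of_ge h0] at hs; linarith [hs.1]
        have := intervalIntegral.integral_add_adjacent_intervals
          (hk.continuous.intervalIntegrable (μ := volume) 0 t)
          (hk.continuous.intervalIntegrable (μ := volume) t 1)
        rw [hrest, hk01, add_zero] at this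
        exact this
    have hφs : tsupport φ ⊆ Icc a b := by
      refine closure_minimal (fun t ht => ?_) isClosed_Icc
      by_contra h'
      exact ht (hφ0 t h')
    have hφc : HasCompactSupport φ := isCompact_Icc.of_isClosed_subset (isClosed_tsupport φ) hφs
    have h0 := h φ hφ hφc (hφs.trans (Icc_subset_Ioo ha hb))
    simp only [hφ', Pi.zero_apply, zero_mul, intervalIntegral.integral_zero, neg_zero] at h0
    have i1 := hf.mul_continuousOn (hη.continuous.continuousOn (s := uIcc 0 1))
    have i2 := hf.mul_continuousOn (hψ.continuous.continuousOn (s := uIcc 0 1))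
    have e1 : ∫ t in (0 : ℝ)..1, f t * k t = (∫ t in (0 : ℝ)..1, f t * η t) - m * c := by
      rw [hc, ← intervalIntegral.integral_const_mul,
        ← intervalIntegral.integral_sub i1 (i2.const_mul m)]
      congr 1; ext t; simp only [k]; ring
    have e2 : ∫ t in (0 : ℝ)..1, η t • (f t - c) = (∫ t in (0 : ℝ)..1, f t * η t) - c * m := by
      rw [hm, ← intervalIntegral.integral_const_mul, ← intervalIntegral.integral_sub i1
        ((hη.continuous.intervalIntegrable _ _).const_mul c)]
      congr 1; ext t; simp only [smul_eq_mul]; ring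
    rw [e2]
    linarith
  filter_upwards [key] with t ht h' using sub_eq_zero.1 (ht h')

lemma continuousOn_primitive {g : ℝ → ℝ} (hg : IntervalIntegrable g volume 0 1) :
    ContinuousOn (fun t => ∫ s in (0 : ℝ)..t, g s) (Icc 0 1) := by
  have := intervalIntegral.continuousOn_primitive_interval' hg (a := 0) (by simp)
  rwa [uIcc_of_le zero_le_one] at this

/-- Integration by parts of a primitive of an integrable function against a function which is
continuously differentiable on `[0,1]`. -/
lemma integral_primitive_mul_der {g p p' : ℝ → ℝ} (hg : IntervalIntegrable g volume 0 1)
    (hp : ∀ t ∈ Icc (0 : ℝ) 1, HasDerivWithinAt p (p' t) (Icc 0 1) t)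
    (hp' : ContinuousOn p' (Icc 0 1)) (c : ℝ) :
    (∫ t in (0 : ℝ)..1, p t * g t) + ∫ t in (0 : ℝ)..1, p' t * (c + ∫ s in (0 : ℝ)..t, g s) =
      p 1 * (c + ∫ s in (0 : ℝ)..1, g s) - p 0 * c := by
  have hu : uIcc (0 : ℝ) 1 = Icc 0 1 := uIcc_of_le zero_le_one
  have hpd : EqOn (derivWithin p (Icc 0 1)) p' (Icc 0 1) := fun t ht =>
    (hp t ht).derivWithin (uIcc01 t ht)
  have hp1 : ContDiffOn ℝ 1 p (Icc 0 1) :=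
    (contDiffOn_one_iff_derivWithin uIcc01).2
      ⟨fun t ht => (hp t ht).differentiableWithinAt, hp'.congr hpd⟩
  have hpac : AbsolutelyContinuousOnInterval p 0 1 := by
    apply ContDiffOn.absolutelyContinuousOnInterval
    rwa [hu]
  have hgac : AbsolutelyContinuousOnInterval (fun t => ∫ s in (0 : ℝ)..t, g s) 0 1 :=
    hg.absolutelyContinuousOnInterval_intervalIntegral (by simp)
  have hparts := hpac.integral_mul_deriv_eq_deriv_mul hgac
  have e1 : ∫ t in (0 : ℝ)..1, p t * deriv (fun t => ∫ s in (0 : ℝ)..t, g s) t =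
      ∫ t in (0 : ℝ)..1, p t * g t := by
    refine intervalIntegral.integral_congr_ae ?_
    filter_upwards [hg.ae_hasDerivAt_integral] with t ht ht'
    rw [(ht (uIoc_subset_uIcc ht') 0 (by simp)).deriv]
  have hder : ∀ t ∈ Ioo (0 : ℝ) 1, deriv p t = p' t := fun t ht =>
    ((hp t (Ioo_subset_Icc_self ht)).hasDerivAt (Icc_mem_nhds ht.1 ht.2)).deriv
  have aeIoo : ∀ᵐ t ∂(volume : Measure ℝ), t ∈ uIoc (0 : ℝ) 1 → t ∈ Ioo (0 : ℝ) 1 := by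
    have : ∀ᵐ t ∂(volume : Measure ℝ), t ≠ 1 := by
      simp [ae_iff]
    filter_upwards [this] with t ht ht'
    rw [uIoc_of_le zero_le_one] at ht'
    exact ⟨ht'.1, lt_of_le_of_ne ht'.2 ht⟩
  have e2 : ∫ t in (0 : ℝ)..1, deriv p t * (∫ s in (0 : ℝ)..t, g s) =
      ∫ t in (0 : ℝ)..1, p' t * (∫ s in (0 : ℝ)..t, g s) := by
    refine intervalIntegral.integral_congr_ae ?_
    filter_upwards [aeIoo] with t ht ht'
    rw [hder t (ht ht')]
  have i1 : IntervalIntegrable p' volume 0 1 := (hu ▸ hp').intervalIntegrable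
  have i2 : IntervalIntegrable (fun t => p' t * ∫ s in (0 : ℝ)..t, g s) volume 0 1 := by
    apply ContinuousOn.intervalIntegrable
    rw [hu]
    exact hp'.mul (continuousOn_primitive hg)
  have e3 : ∫ t in (0 : ℝ)..1, p' t = p 1 - p 0 := by
    refine intervalIntegral.integral_eq_sub_of_hasDeriv_right_of_le zero_le_one
      (fun t ht => (hp t ht).continuousWithinAt) (fun t ht => ?_) i1
    exact ((hp t (Ioo_subset_Icc_self ht)).hasDerivAt (Icc_mem_nhds ht.1 ht.2)).hasDerivWithinAt
  have e4 : ∫ t in (0 : ℝ)..1, p' t * (c + ∫ s in (0 : ℝ)..t, g s) =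
      c * (p 1 - p 0) + ∫ t in (0 : ℝ)..1, p' t * (∫ s in (0 : ℝ)..t, g s) := by
    rw [← e3, ← intervalIntegral.integral_const_mul,
      ← intervalIntegral.integral_add (i1.const_mul c) i2]
    congr 1; ext t; ring
  rw [e1, e2] at hparts
  simp only [intervalIntegral.integral_same, mul_zero, sub_zero] at hparts
  rw [e4]
  linarith

/-- An integrable function with an integrable weak derivative is almost everywhere a primitive of
the latter. -/
lemma IsWeakDeriv.ae_eq_primitive {f g : ℝ → ℝ} (hf : IntervalIntegrable f volume 0 1)
    (hg : IntervalIntegrable g volume 0 1) (h : IsWeakDeriv f g) :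
    ∃ c, ∀ᵐ t ∂(volume.restrict (Ioc (0 : ℝ) 1)), f t = c + ∫ s in (0 : ℝ)..t, g s := by
  have hu : uIcc (0 : ℝ) 1 = Icc 0 1 := uIcc_of_le zero_le_one
  have hG := continuousOn_primitive hg
  have hGi : IntervalIntegrable (fun t => ∫ s in (0 : ℝ)..t, g s) volume 0 1 :=
    (hu ▸ hG).intervalIntegrable
  obtain ⟨c, hc⟩ := IsWeakDeriv.ae_const_of_zero (f := fun t => f t - ∫ s in (0 : ℝ)..t, g s)
    (hf.sub hGi) (by
      intro φ hφ hφc hφs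
      have hd : Continuous (deriv φ) := hφ.continuous_deriv (by simp)
      have h1 := integral_primitive_mul_der (p := φ) (p' := deriv φ) hg
        (fun t _ => (hφ.differentiable (by simp) t).hasDerivAt.hasDerivWithinAt)
        hd.continuousOn 0
      have h00 : φ 0 = 0 := image_eq_zero_of_notMem_tsupport fun h' => by simpa using hφs h'
      have h11 : φ 1 = 0 := image_eq_zero_of_notMem_tsupport fun h' => by simpa using hφs h'
      simp only [h00, h11, zero_add, zero_mul, sub_zero] at h1
      have h2 := h φ hφ hφc hφs
      have i1 : IntervalIntegrable (fun t => f t * deriv φ t) volume 0 1 :=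
        hf.mul_continuousOn hd.continuousOn
      have i2 : IntervalIntegrable (fun t => deriv φ t * ∫ s in (0 : ℝ)..t, g s) volume 0 1 :=
        (hu ▸ hd.continuousOn.mul hG).intervalIntegrable
      have e : ∫ t in (0 : ℝ)..1, (f t - ∫ s in (0 : ℝ)..t, g s) * deriv φ t =
          (∫ t in (0 : ℝ)..1, f t * deriv φ t) -
            ∫ t in (0 : ℝ)..1, deriv φ t * ∫ s in (0 : ℝ)..t, g s := by
        rw [← intervalIntegral.integral_sub i1 i2]
        congr 1; ext t; ring
      have e' : ∫ t in (0 : ℝ)..1, φ t * g t = ∫ t in (0 : ℝ)..1, g t * φ t := by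
        simp only [mul_comm]
      simp only [Pi.zero_apply, zero_mul, intervalIntegral.integral_zero, neg_zero]
      rw [e, h2]
      linarith)
  refine ⟨c, ?_⟩
  filter_upwards [hc] with t ht
  linarith

/-- A continuous function with an integrable weak derivative is the primitive of the latter. -/
lemma IsWeakDeriv.eq_primitive {f g : ℝ → ℝ} (hf : ContinuousOn f (Icc 0 1))
    (hg : IntervalIntegrable g volume 0 1) (h : IsWeakDeriv f g) {t : ℝ} (ht : t ∈ Icc (0 : ℝ) 1) :
    f t = f 0 + ∫ s in (0 : ℝ)..t, g s := by
  have hfi : IntervalIntegrable f volume 0 1 :=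
    ((uIcc_of_le (zero_le_one (α := ℝ))).symm ▸ hf).intervalIntegrable
  obtain ⟨c, hc⟩ := h.ae_eq_primitive hfi hg
  -- two continuous functions on `[0,1]` that agree almost everywhere agree everywhere
  have heq : EqOn f (fun t => c + ∫ s in (0 : ℝ)..t, g s) (Icc 0 1) := by
    refine Measure.eqOn_Icc_of_ae_eq volume zero_ne_one ?_ hf
      (continuousOn_const.add (continuousOn_primitive hg))
    rw [Measure.restrict_congr_set Ioc_ae_eq_Icc.symm]
    exact hc
  have h1 := heq ht
  have h0 := heq (left_mem_Icc.2 zero_le_one)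
  simp only [intervalIntegral.integral_same, add_zero] at h0 h1
  rw [h1, h0]

lemma hasDerivWithinAt_primitive {g : ℝ → ℝ} (hg : ContinuousOn g (Icc 0 1)) (c : ℝ) {t : ℝ}
    (ht : t ∈ Icc (0 : ℝ) 1) :
    HasDerivWithinAt (fun t => c + ∫ s in (0 : ℝ)..t, g s) (g t) (Icc 0 1) t := by
  have : Fact (t ∈ Icc (0 : ℝ) 1) := ⟨ht⟩
  refine (intervalIntegral.integral_hasDerivWithinAt_right ?_
    (hg.stronglyMeasurableAtFilter_nhdsWithin measurableSet_Icc t) (hg t ht)).const_add c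
  refine (hg.mono ?_).intervalIntegrable
  rw [uIcc_of_le ht.1]
  exact Icc_subset_Icc_right ht.2

/-- Integration by parts of a Sobolev function against a function which is continuously
differentiable on `[0,1]`. -/
lemma integral_mul_weakDeriv {f : C(I, ℝ)} (hf : MemW12 f) {p p' : ℝ → ℝ}
    (hp : ∀ t ∈ Icc (0 : ℝ) 1, HasDerivWithinAt p (p' t) (Icc 0 1) t)
    (hp' : ContinuousOn p' (Icc 0 1)) :
    (∫ t in (0 : ℝ)..1, p t * weakDeriv f t) + ∫ t in (0 : ℝ)..1, p' t * ext f t =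
      p 1 * ext f 1 - p 0 * ext f 0 := by
  have hg := intervalIntegrable_of_memLp (weakDeriv_memLp hf)
  have hprim : ∀ t ∈ Icc (0 : ℝ) 1, ext f t = ext f 0 + ∫ s in (0 : ℝ)..t, weakDeriv f s :=
    fun t ht => (weakDeriv_spec hf).eq_primitive (ext_continuous f).continuousOn hg ht
  have h := integral_primitive_mul_der hg hp hp' (ext f 0)
  rw [← hprim 1 (by simp)] at h
  rw [← h]
  congr 1
  refine intervalIntegral.integral_congr fun t ht => ?_
  rw [uIcc_of_le zero_le_one] at ht
  rw [← hprim t ht]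

/-- A function that is continuously differentiable on `[0,1]` has its derivative as weak
derivative. -/
lemma isWeakDeriv_of_hasDerivWithinAt {f f' : ℝ → ℝ}
    (hf : ∀ t ∈ Icc (0 : ℝ) 1, HasDerivWithinAt f (f' t) (Icc 0 1) t)
    (hf' : ContinuousOn f' (Icc 0 1)) : IsWeakDeriv f f' := by
  intro φ hφ hφc hφs
  have hu : uIcc (0 : ℝ) 1 = Icc 0 1 := uIcc_of_le zero_le_one
  have hd : Continuous (deriv φ) := hφ.continuous_deriv (by simp)
  have h00 : φ 0 = 0 := image_eq_zero_of_notMem_tsupport fun h' => by simpa using hφs h'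
  have h11 : φ 1 = 0 := image_eq_zero_of_notMem_tsupport fun h' => by simpa using hφs h'
  have := intervalIntegral.integral_mul_deriv_eq_deriv_mul_of_hasDerivWithinAt (a := 0) (b := 1)
    (u := f) (v := φ) (u' := f') (v' := deriv φ) (by rw [hu]; exact hf)
    (fun t _ => (hφ.differentiable (by simp) t).hasDerivAt.hasDerivWithinAt)
    (hu ▸ hf').intervalIntegrable (hd.intervalIntegrable _ _)
  rw [this, h00, h11]
  ring

/-! ### Linear first order systems on the unit interval -/

/-- `(f, p)` solves the linear system `f' = α p`, `p' = β f` on `[0,1]`. -/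
def IsLinearSol (α β f p : ℝ → ℝ) : Prop :=
  ∀ t ∈ Icc (0 : ℝ) 1, HasDerivWithinAt f (α t * p t) (Icc 0 1) t ∧
    HasDerivWithinAt p (β t * f t) (Icc 0 1) t

/-- Grönwall's inequality on `[0,1]`, for one-sided derivatives at the ends. -/
lemma norm_le_exp_of_norm_deriv_le {x x' : ℝ → ℝ × ℝ} {K : ℝ} (hK : 0 ≤ K)
    (hx : ∀ t ∈ Icc (0 : ℝ) 1, HasDerivWithinAt x (x' t) (Icc 0 1) t)
    (hb : ∀ t ∈ Icc (0 : ℝ) 1, ‖x' t‖ ≤ K * ‖x t‖) {t : ℝ} (ht : t ∈ Icc (0 : ℝ) 1) :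
    ‖x t‖ ≤ ‖x 0‖ * Real.exp K := by
  have := norm_le_gronwallBound_of_norm_deriv_right_le (f := x) (f' := x') (δ := ‖x 0‖) (K := K)
    (ε := 0) (a := 0) (b := 1) (fun t ht => (hx t ht).continuousWithinAt)
    (fun t ht => (hx t (Ico_subset_Icc_self ht)).mono_of_mem_nhdsWithin
      (Filter.mem_of_superset (Icc_mem_nhdsGE ht.2) (Icc_subset_Icc_left ht.1)))
    le_rfl (fun t ht => by simpa using hb t (Ico_subset_Icc_self ht)) t ht
  rw [gronwallBound_ε0, sub_zero] at this
  refine this.trans (mul_le_mul_of_nonneg_left (Real.exp_le_exp.2 ?_) (norm_nonneg _))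
  nlinarith [ht.1, ht.2]

lemma IsLinearSol.eq_zero {α β f p : ℝ → ℝ} (hα : ContinuousOn α (Icc 0 1))
    (hβ : ContinuousOn β (Icc 0 1)) (h : IsLinearSol α β f p) (hf : f 0 = 0) (hp : p 0 = 0)
    {t : ℝ} (ht : t ∈ Icc (0 : ℝ) 1) : f t = 0 := by
  obtain ⟨A, hA⟩ := isCompact_Icc.exists_bound_of_continuousOn hα
  obtain ⟨B, hB⟩ := isCompact_Icc.exists_bound_of_continuousOn hβ
  have hK : 0 ≤ max A B := le_max_of_le_left ((norm_nonneg _).trans (hA t ht))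
  have := norm_le_exp_of_norm_deriv_le (x := fun t => (f t, p t))
    (x' := fun t => (α t * p t, β t * f t)) hK (fun t ht => (h t ht).1.prodMk (h t ht).2)
    (fun t ht => by
      rw [norm_prod_le_iff, norm_mul, norm_mul]
      exact ⟨mul_le_mul ((hA t ht).trans (le_max_left _ _)) (norm_snd_le (f t, p t))
          (norm_nonneg _) hK,
        mul_le_mul ((hB t ht).trans (le_max_right _ _)) (norm_fst_le (f t, p t))
          (norm_nonneg _) hK⟩) ht
  simp only [hf, hp, Prod.mk_zero_zero, norm_zero, zero_mul, norm_le_zero_iff,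
    Prod.mk_eq_zero] at this
  exact this.1

/-- The initial value problem for the linear system is solvable on the whole interval. The
Picard-Lindelöf theorem applies to the bounded system obtained by truncating the unknowns at a
height which, by Grönwall's inequality, the solution does not reach. -/
lemma exists_isLinearSol_zero {α β : ℝ → ℝ} (hα : ContinuousOn α (Icc 0 1))
    (hβ : ContinuousOn β (Icc 0 1)) (x y : ℝ) :
    ∃ f p, IsLinearSol α β f p ∧ f 0 = x ∧ p 0 = y := by
  obtain ⟨A, hA⟩ := isCompact_Icc.exists_bound_of_continuousOn hα
  obtain ⟨B, hB⟩ := isCompact_Icc.exists_bound_of_continuousOn hβ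
  set K := max A B with hKdef
  have hK : 0 ≤ K :=
    le_max_of_le_left ((norm_nonneg _).trans (hA 0 (left_mem_Icc.2 zero_le_one)))
  have hAK : ∀ t ∈ Icc (0 : ℝ) 1, ‖α t‖ ≤ K := fun t ht => (hA t ht).trans (le_max_left _ _)
  have hBK : ∀ t ∈ Icc (0 : ℝ) 1, ‖β t‖ ≤ K := fun t ht => (hB t ht).trans (le_max_right _ _)
  set R := ‖(x, y)‖ * Real.exp K with hR
  have hR0 : 0 ≤ R := by positivity
  let χ : ℝ → ℝ := fun z => max (-R) (min R z)
  have hχL : ∀ a b, ‖χ a - χ b‖ ≤ ‖a - b‖ := fun a b => by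
    have : LipschitzWith 1 χ := (LipschitzWith.id.const_min R).const_max (-R)
    simpa using this.norm_sub_le a b
  have hχ0 : χ 0 = 0 := by simp [χ, hR0]
  have hχn : ∀ a, ‖χ a‖ ≤ ‖a‖ := fun a => by simpa [hχ0] using hχL a 0
  have hχR : ∀ a, ‖χ a‖ ≤ R := fun a => by
    rw [Real.norm_eq_abs, abs_le]
    exact ⟨le_max_left _ _, max_le (by linarith) (min_le_left _ _)⟩
  have hχid : ∀ a, ‖a‖ ≤ R → χ a = a := fun a ha => by
    rw [Real.norm_eq_abs, abs_le] at ha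
    simp [χ, ha.1, ha.2]
  let v : ℝ → ℝ × ℝ → ℝ × ℝ := fun t z => (α t * χ z.2, β t * χ z.1)
  have hPL : IsPicardLindelof v (tmin := 0) (tmax := 1) ⟨0, left_mem_Icc.2 zero_le_one⟩ (x, y)
      (K * R).toNNReal 0 (K * R).toNNReal K.toNNReal := by
    refine ⟨fun t ht => LipschitzWith.lipschitzOnWith ?_, fun z _ => ?_, fun t ht z _ => ?_, ?_⟩
    · refine LipschitzWith.of_dist_le_mul fun z w => ?_
      rw [dist_eq_norm, dist_eq_norm, Real.coe_toNNReal _ hK, norm_prod_le_iff]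
      simp only [v, Prod.fst_sub, Prod.snd_sub, ← mul_sub, norm_mul]
      exact ⟨mul_le_mul (hAK t ht) ((hχL _ _).trans (norm_snd_le (z - w))) (norm_nonneg _) hK,
        mul_le_mul (hBK t ht) ((hχL _ _).trans (norm_fst_le (z - w))) (norm_nonneg _) hK⟩
    · exact (hα.mul continuousOn_const).prodMk (hβ.mul continuousOn_const)
    · rw [Real.coe_toNNReal _ (mul_nonneg hK hR0), norm_prod_le_iff]
      simp only [v, norm_mul]
      exact ⟨mul_le_mul (hAK t ht) (hχR _) (norm_nonneg _) hK,
        mul_le_mul (hBK t ht) (hχR _) (norm_nonneg _) hK⟩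
    · simp
  obtain ⟨z, hz0, hz⟩ := hPL.exists_eq_forall_mem_Icc_hasDerivWithinAt₀
  have hz0' : z 0 = (x, y) := hz0
  have hzR : ∀ t ∈ Icc (0 : ℝ) 1, ‖z t‖ ≤ R := fun t ht => by
    rw [hR, ← hz0']
    refine norm_le_exp_of_norm_deriv_le hK hz (fun t ht => ?_) ht
    rw [norm_prod_le_iff]
    simp only [v, norm_mul]
    exact ⟨mul_le_mul (hAK t ht) ((hχn _).trans (norm_snd_le _)) (norm_nonneg _) hK,
      mul_le_mul (hBK t ht) ((hχn _).trans (norm_fst_le _)) (norm_nonneg _) hK⟩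
  refine ⟨fun t => (z t).1, fun t => (z t).2, fun t ht => ?_, by simp [hz0'], by simp [hz0']⟩
  have h := hz t ht
  have h1 := hχid _ ((norm_fst_le _).trans (hzR t ht))
  have h2 := hχid _ ((norm_snd_le _).trans (hzR t ht))
  simp only [v, h1, h2] at h
  exact ⟨h.fst, h.snd⟩

/-- The system is solvable with arbitrary data at either end of the interval. -/
lemma exists_isLinearSol {α β : ℝ → ℝ} (hα : ContinuousOn α (Icc 0 1))
    (hβ : ContinuousOn β (Icc 0 1)) (b : Bool) (x y : ℝ) :
    ∃ f p, IsLinearSol α β f p ∧ f (endParam b) = x ∧ p (endParam b) = y := by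
  cases b with
  | false => exact exists_isLinearSol_zero hα hβ x y
  | true =>
    have hm : MapsTo (fun t : ℝ => 1 - t) (Icc 0 1) (Icc 0 1) := fun t ht =>
      ⟨by linarith [ht.2], by linarith [ht.1]⟩
    have hc : ContinuousOn (fun t : ℝ => 1 - t) (Icc 0 1) := by fun_prop
    obtain ⟨f, p, h, hf, hp⟩ := exists_isLinearSol_zero (hα.comp hc hm).neg (hβ.comp hc hm).neg x y
    refine ⟨fun t => f (1 - t), fun t => p (1 - t), fun t ht => ?_, by simpa [endParam] using hf,
      by simpa [endParam] using hp⟩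
    have hd : HasDerivWithinAt (fun t : ℝ => 1 - t) (-1) (Icc 0 1) t := by
      simpa using (hasDerivWithinAt_id t (Icc (0 : ℝ) 1)).const_sub 1
    have h1 := (h _ (hm ht)).1.scomp t hd hm
    have h2 := (h _ (hm ht)).2.scomp t hd hm
    simp only [Function.comp_def, sub_sub_cancel, smul_eq_mul, Pi.neg_apply, neg_mul, one_mul,
      neg_neg] at h1 h2
    exact ⟨h1, h2⟩

lemma IsLinearSol.contDiffOn {α β f p : ℝ → ℝ} (hα : ContDiffOn ℝ ∞ α (Icc 0 1))
    (hβ : ContDiffOn ℝ ∞ β (Icc 0 1)) (h : IsLinearSol α β f p) :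
    ContDiffOn ℝ ∞ f (Icc 0 1) ∧ ContDiffOn ℝ ∞ p (Icc 0 1) := by
  suffices H : ∀ n : ℕ, ContDiffOn ℝ n f (Icc 0 1) ∧ ContDiffOn ℝ n p (Icc 0 1) from
    ⟨contDiffOn_infty.2 fun n => (H n).1, contDiffOn_infty.2 fun n => (H n).2⟩
  intro n
  induction n with
  | zero =>
    simp only [Nat.cast_zero, contDiffOn_zero]
    exact ⟨fun t ht => (h t ht).1.continuousWithinAt, fun t ht => (h t ht).2.continuousWithinAt⟩
  | succ n ih =>
    have hn : (n : WithTop ℕ∞) ≤ (∞ : WithTop ℕ∞) := by exact_mod_cast le_top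
    have e1 : EqOn (derivWithin f (Icc 0 1)) (fun t => α t * p t) (Icc 0 1) := fun t ht =>
      (h t ht).1.derivWithin (uIcc01 t ht)
    have e2 : EqOn (derivWithin p (Icc 0 1)) (fun t => β t * f t) (Icc 0 1) := fun t ht =>
      (h t ht).2.derivWithin (uIcc01 t ht)
    push_cast
    rw [contDiffOn_succ_iff_derivWithin uIcc01, contDiffOn_succ_iff_derivWithin uIcc01]
    exact ⟨⟨fun t ht => (h t ht).1.differentiableWithinAt, by simp,
        ((hα.of_le hn).mul ih.2).congr e1⟩,
      ⟨fun t ht => (h t ht).2.differentiableWithinAt, by simp,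
        ((hβ.of_le hn).mul ih.1).congr e2⟩⟩

/-! ### Smooth functions as Sobolev functions -/

variable {ι : Type*} [Fintype ι]

lemma ext_of_mem {F : Type*} [TopologicalSpace F] (f : C(I, F)) {t : ℝ} (ht : t ∈ Icc (0 : ℝ) 1) :
    ext f t = f ⟨t, ht⟩ :=
  IccExtend_of_mem _ _ ht

lemma ext_coe {F : Type*} [TopologicalSpace F] (f : C(I, F)) (t : I) : ext f t = f t :=
  ext_of_mem f t.2

lemma hasDerivWithinAt_der {f : ℝ → ℝ} (hf : ContDiffOn ℝ ∞ f (Icc 0 1)) {t : ℝ}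
    (ht : t ∈ Icc (0 : ℝ) 1) : HasDerivWithinAt f (der f t) (Icc 0 1) t :=
  (hf.differentiableOn (by simp) t ht).hasDerivWithinAt

lemma der_continuousOn {f : ℝ → ℝ} (hf : ContDiffOn ℝ ∞ f (Icc 0 1)) :
    ContinuousOn (der f) (Icc 0 1) :=
  hf.continuousOn_derivWithin uIcc01 (by simp)

lemma isWeakDeriv_der {f : C(I, ℝ)} (hf : IsSmooth f) : IsWeakDeriv (ext f) (der (ext f)) :=
  isWeakDeriv_of_hasDerivWithinAt (fun _ ht => hasDerivWithinAt_der hf ht)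
    (der_continuousOn hf)

lemma memLp_of_continuousOn {g : ℝ → ℝ} (hg : ContinuousOn g (Icc 0 1)) :
    MemLp g 2 (volume.restrict (Ioc 0 1)) := by
  obtain ⟨C, hC⟩ := isCompact_Icc.exists_bound_of_continuousOn hg
  refine MemLp.of_bound ((hg.mono Ioc_subset_Icc_self).aestronglyMeasurable measurableSet_Ioc) C ?_
  exact (ae_restrict_iff' measurableSet_Ioc).2
    (Filter.Eventually.of_forall fun t ht => hC t (Ioc_subset_Icc_self ht))

lemma IsSmooth.memW12 {f : C(I, ℝ)} (hf : IsSmooth f) : MemW12 f :=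
  ⟨_, memLp_of_continuousOn (der_continuousOn hf), isWeakDeriv_der hf⟩

lemma IsSmooth.weakDeriv_ae_eq {f : C(I, ℝ)} (hf : IsSmooth f) :
    weakDeriv f =ᵐ[volume.restrict (Ioc 0 1)] der (ext f) :=
  isWeakDeriv_unique (weakDeriv_spec hf.memW12) (isWeakDeriv_der hf) (weakDeriv_memLp hf.memW12)
    (memLp_of_continuousOn (der_continuousOn hf))

lemma smoothFun_le_sobolev : smoothFun ι ≤ sobolev ι :=
  fun _ hu i => (hu i).memW12

namespace Network

/-! ### The equation `L u = 0` as a linear system -/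

lemma speed_mul_arcDeriv (N : Network ι) (i : ι) (f : ℝ → ℝ) {t : ℝ} (ht : t ∈ Icc (0 : ℝ) 1) :
    speed (N.γ i) t * arcDeriv (N.γ i) f t = der f t :=
  mul_div_cancel₀ _ (N.speed_ne_zero i ht)

/-- A solution of `L u = 0` and its arc length derivative form a solution of a linear first order
system on each curve. -/
lemma IsLNull.isLinearSol {N : Network ι} {d : ι → C(I, ℝ)} {u : smoothFun ι}
    (h : N.IsLNull d u) (i : ι) :
    IsLinearSol (speed (N.γ i)) (fun t => -(speed (N.γ i) t * ext (d i) t)) (ext (u.1 i))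
      (arcDeriv (N.γ i) (ext (u.1 i))) := by
  intro t ht
  have hs := N.arcDeriv_contDiffOn i (u.2 i)
  refine ⟨?_, ?_⟩
  · rw [N.speed_mul_arcDeriv i _ ht]
    exact hasDerivWithinAt_der (u.2 i) ht
  · have h1 := hasDerivWithinAt_der hs ht
    rw [← N.speed_mul_arcDeriv i _ ht] at h1
    convert h1 using 1
    have := h i ⟨t, ht⟩
    rw [lap, ← ext_of_mem _ ht, ← ext_of_mem _ ht] at this
    simp only at this
    linear_combination -speed (N.γ i) t * this

/-- Conversely, solutions of the linear system are smooth solutions of `L u = 0`. -/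
lemma exists_isLNull_of_isLinearSol (N : Network ι) {d : ι → C(I, ℝ)} (hd : d ∈ smoothFun ι)
    {u : ι → C(I, ℝ)} {p : ι → ℝ → ℝ}
    (h : ∀ i, IsLinearSol (speed (N.γ i)) (fun t => -(speed (N.γ i) t * ext (d i) t))
      (ext (u i)) (p i)) :
    ∃ hu : u ∈ smoothFun ι, N.IsLNull d ⟨u, hu⟩ ∧
      ∀ i, ∀ t ∈ Icc (0 : ℝ) 1, arcDeriv (N.γ i) (ext (u i)) t = p i t := by
  have hs := N.speed_contDiffOn
  have hu : ∀ i, IsSmooth (u i) := fun i => ((h i).contDiffOn (hs i) ((hs i).mul (hd i)).neg).1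
  have hp : ∀ i, ∀ t ∈ Icc (0 : ℝ) 1, arcDeriv (N.γ i) (ext (u i)) t = p i t := by
    intro i t ht
    rw [arcDeriv, der, (h i t ht).1.derivWithin (uIcc01 t ht),
      mul_div_cancel_left₀ _ (N.speed_ne_zero i ht)]
  refine ⟨hu, fun i t => ?_, hp⟩
  have hs0 := N.speed_ne_zero i t.2
  have hl : lap (N.γ i) (ext (u i)) t = -(d i t * u i t) := by
    rw [lap, arcDeriv, der, derivWithin_congr (hp i) (hp i t t.2),
      (h i t t.2).2.derivWithin (uIcc01 t t.2)]
    simp only [ext_coe]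
    field_simp
  change lap (N.γ i) (ext (u i)) t + d i t * u i t = 0
  rw [hl, neg_add_cancel]

/-- The space of smooth solutions of `L u = 0`, without boundary conditions. -/
def solSpace (N : Network ι) (d : ι → C(I, ℝ)) : Submodule ℝ (smoothFun ι) where
  carrier := {u | N.IsLNull d u}
  zero_mem' := (N.nullFun d).zero_mem.1
  add_mem' := by
    intro u v hu hv i t
    have := N.lap_add i (u.2 i) (v.2 i) t.2
    simp only [Submodule.coe_add, Pi.add_apply, ext_add, this, ContinuousMap.add_apply]
    linear_combination hu i t + hv i t
  smul_mem' := by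
    intro c u hu i t
    have := N.lap_smul i c (u.2 i) t.2
    simp only [SetLike.val_smul, Pi.smul_apply, ext_smul, this, ContinuousMap.smul_apply,
      smul_eq_mul]
    linear_combination c * hu i t

lemma mem_solSpace {N : Network ι} {d : ι → C(I, ℝ)} {u : smoothFun ι} :
    u ∈ N.solSpace d ↔ N.IsLNull d u := Iff.rfl

/-- The values of a smooth function at all ends of curves. -/
def endVal (N : Network ι) : smoothFun ι →ₗ[ℝ] EuclideanSpace ℝ (ι × Bool) where
  toFun u := WithLp.toLp 2 fun e => N.trace univ u.1 ⟨e, mem_univ _⟩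
  map_add' u v := by ext e; simp
  map_smul' c u := by ext e; simp

/-- The outer normal derivatives of a smooth function at all ends of curves. -/
def endDer (N : Network ι) : smoothFun ι →ₗ[ℝ] EuclideanSpace ℝ (ι × Bool) where
  toFun u := WithLp.toLp 2 fun e => N.normalDeriv univ u ⟨e, mem_univ _⟩
  map_add' u v := by ext e; simp
  map_smul' c u := by ext e; simp

lemma endVal_apply (N : Network ι) (u : smoothFun ι) (e : ι × Bool) :
    N.endVal u e = u.1 e.1 (endParam e.2) := rfl

lemma endDer_apply (N : Network ι) (u : smoothFun ι) (e : ι × Bool) :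
    N.endDer u e = outSign e.2 * arcDeriv (N.γ e.1) (ext (u.1 e.1)) (endParam e.2) := rfl

lemma outSign_mul_self (b : Bool) : outSign b * outSign b = 1 := by cases b <;> simp [outSign]

/-- At one end of each curve the Cauchy data of a solution of `L u = 0` can be prescribed. -/
lemma exists_isLNull (N : Network ι) {d : ι → C(I, ℝ)} (hd : d ∈ smoothFun ι) (b : Bool)
    (x y : ι → ℝ) :
    ∃ u, N.IsLNull d u ∧ ∀ i, N.endVal u (i, b) = x i ∧ N.endDer u (i, b) = y i := by
  have hs := N.speed_contDiffOn
  choose f p h hf hp using fun i => exists_isLinearSol (hs i).continuousOn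
    ((hs i).mul (hd i)).neg.continuousOn b (x i) (outSign b * y i)
  have hfc : ∀ i, ContinuousOn (f i) (Icc 0 1) := fun i t ht => (h i t ht).1.continuousWithinAt
  let u : ι → C(I, ℝ) := fun i => ⟨(Icc 0 1).domRestrict (f i), (hfc i).domRestrict⟩
  have hu : ∀ i, EqOn (ext (u i)) (f i) (Icc 0 1) := fun i t ht => by
    rw [ext_of_mem _ ht]; rfl
  obtain ⟨hus, hL, hd⟩ := N.exists_isLNull_of_isLinearSol hd (u := u) (p := p) (fun i t ht => by
    refine ⟨(h i t ht).1.congr (hu i) (hu i ht), ?_⟩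
    rw [hu i ht]
    exact (h i t ht).2)
  refine ⟨⟨u, hus⟩, hL, fun i => ⟨hf i, ?_⟩⟩
  rw [endDer_apply, hd i _ (endParam b).2, hp i, ← mul_assoc, outSign_mul_self, one_mul]

lemma IsLNull.eq_zero {N : Network ι} {d : ι → C(I, ℝ)} {u : smoothFun ι}
    (h : N.IsLNull d u) (h0 : N.endVal u = 0) (h1 : N.endDer u = 0) : u = 0 := by
  ext i t
  have hs := N.speed_contDiffOn i
  have hv : N.endVal u (i, false) = 0 := by rw [h0]; rfl
  have hp : N.endDer u (i, false) = 0 := by rw [h1]; rfl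
  rw [endVal_apply, ← ext_coe] at hv
  rw [endDer_apply] at hp
  simp only [endParam, outSign, Icc.coe_zero] at hv hp
  have := (h.isLinearSol i).eq_zero hs.continuousOn
    (hs.continuousOn.mul (ext_continuous _).continuousOn).neg hv (by linarith) t.2
  rw [ext_coe] at this
  simpa using this

instance (N : Network ι) (d : ι → C(I, ℝ)) : FiniteDimensional ℝ (N.solSpace d) := by
  refine Module.Finite.of_injective ((N.endVal.prod N.endDer).domRestrict (N.solSpace d)) ?_
  refine (injective_iff_map_eq_zero _).2 fun u hu => ?_
  obtain ⟨h0, h1⟩ := Prod.ext_iff.1 hu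
  exact Subtype.ext (u.2.eq_zero h0 h1)

/-! ### Green's formula -/

lemma indexForm_comm (N : Network ι) (d u v : ι → C(I, ℝ)) :
    N.indexForm d u v = N.indexForm d v u := by
  simp only [indexForm, arcIntegral]
  refine Finset.sum_congr rfl fun i _ => ?_
  congr 1
  ext t
  ring

/-- The index form with a smooth second argument, in terms of the classical derivative. -/
lemma indexForm_smooth (N : Network ι) (d u : ι → C(I, ℝ)) {v : ι → C(I, ℝ)}
    (hv : v ∈ smoothFun ι) :
    N.indexForm d u v = ∑ i, ∫ t in (0 : ℝ)..1,
      (weakDeriv (u i) t / speed (N.γ i) t * der (ext (v i)) t -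
        speed (N.γ i) t * ext (d i) t * ext (u i) t * ext (v i) t) := by
  simp only [indexForm, arcIntegral]
  refine Finset.sum_congr rfl fun i _ => ?_
  refine intervalIntegral.integral_congr_ae_restrict ?_
  rw [uIoc_of_le zero_le_one]
  filter_upwards [(hv i).weakDeriv_ae_eq, ae_restrict_mem measurableSet_Ioc] with t ht ht'
  have := N.speed_ne_zero i (Ioc_subset_Icc_self ht')
  rw [ht]
  field_simp

/-- **Green's formula**: for a solution of `L u = 0` the index form reduces to boundary terms. -/
lemma IsLNull.indexForm_eq {N : Network ι} {d : ι → C(I, ℝ)} {u : smoothFun ι}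
    (h : N.IsLNull d u) {v : ι → C(I, ℝ)} (hv : v ∈ sobolev ι) :
    N.indexForm d v u.1 = ∑ e : ι × Bool, v e.1 (endParam e.2) * N.endDer u e := by
  rw [indexForm_smooth N d v u.2, Fintype.sum_prod_type]
  refine Finset.sum_congr rfl fun i _ => ?_
  have hu : uIcc (0 : ℝ) 1 = Icc 0 1 := uIcc_of_le zero_le_one
  have hs := (N.speed_contDiffOn i).continuousOn
  have hp := (N.arcDeriv_contDiffOn i (u.2 i)).continuousOn
  have hq : ContinuousOn (fun t => -(speed (N.γ i) t * ext (d i) t) * ext (u.1 i) t) (Icc 0 1) :=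
    (hs.mul (ext_continuous _).continuousOn).neg.mul (ext_continuous _).continuousOn
  have key := integral_mul_weakDeriv (hv i) (fun t ht => (h.isLinearSol i t ht).2) hq
  have i1 : IntervalIntegrable (fun t => arcDeriv (N.γ i) (ext (u.1 i)) t * weakDeriv (v i) t)
      volume 0 1 :=
    (intervalIntegrable_of_memLp (weakDeriv_memLp (hv i))).continuousOn_mul (hu ▸ hp)
  have i2 : IntervalIntegrable (fun t =>
      -(speed (N.γ i) t * ext (d i) t) * ext (u.1 i) t * ext (v i) t) volume 0 1 :=
    (hu ▸ hq.mul (ext_continuous _).continuousOn).intervalIntegrable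
  rw [← intervalIntegral.integral_add i1 i2] at key
  simp only [Fintype.sum_bool, endDer_apply, outSign, endParam, Icc.coe_one, Icc.coe_zero]
  have e0 : ext (v i) 0 = v i 0 := ext_coe (v i) 0
  have e1 : ext (v i) 1 = v i 1 := ext_coe (v i) 1
  rw [e0, e1] at key
  refine Eq.trans ?_ (key.trans (by ring))
  congr 1
  ext t
  simp only [arcDeriv]
  ring

/-- The Wronskian identity: the boundary pairing of two solutions of `L u = 0` is symmetric. -/
lemma IsLNull.inner_endVal_endDer {N : Network ι} {d : ι → C(I, ℝ)} {u v : smoothFun ι}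
    (hu : N.IsLNull d u) (hv : N.IsLNull d v) :
    ⟪N.endVal u, N.endDer v⟫_ℝ = ⟪N.endDer u, N.endVal v⟫_ℝ := by
  have h1 := hu.indexForm_eq (smoothFun_le_sobolev v.2)
  have h2 := hv.indexForm_eq (smoothFun_le_sobolev u.2)
  rw [indexForm_comm, h2] at h1
  simp only [PiLp.inner_apply, RCLike.inner_apply, conj_trivial]
  simp only [mul_comm, endVal_apply] at h1 ⊢
  exact h1

end Network

lemma euclidean_inner_eq_sum {κ : Type*} [Fintype κ] (a b : EuclideanSpace ℝ κ) :
    ⟪a, b⟫_ℝ = ∑ k, b k * a k := rfl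

namespace Network

/-! ### Boundary data at the ends of curves -/

/-- The restriction of data at all ends of curves to the ends over `A`. -/
def resV (N : Network ι) (A : Set E3) : EuclideanSpace ℝ (ι × Bool) →ₗ[ℝ] N.V A where
  toFun a := WithLp.toLp 2 fun e => a e.1
  map_add' a b := by ext e; simp
  map_smul' c a := by ext e; simp

open Classical in
/-- The extension by zero of data at the ends over `A`. -/
def extV (N : Network ι) (A : Set E3) : N.V A →ₗ[ℝ] EuclideanSpace ℝ (ι × Bool) where
  toFun a := WithLp.toLp 2 fun e => if h : N.endpt e ∈ A then a ⟨e, h⟩ else 0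
  map_add' a b := by ext e; by_cases h : N.endpt e ∈ A <;> simp [h]
  map_smul' c a := by ext e; by_cases h : N.endpt e ∈ A <;> simp [h]

lemma resV_apply (N : Network ι) (A : Set E3) (a : EuclideanSpace ℝ (ι × Bool)) (e : N.Ends A) :
    N.resV A a e = a e.1 := rfl

lemma extV_of_mem (N : Network ι) {A : Set E3} (a : N.V A) {e : ι × Bool}
    (h : N.endpt e ∈ A) : N.extV A a e = a ⟨e, h⟩ := by
  simp [extV, h]

lemma extV_of_notMem (N : Network ι) {A : Set E3} (a : N.V A) {e : ι × Bool}
    (h : N.endpt e ∉ A) : N.extV A a e = 0 := by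
  simp [extV, h]

lemma resV_endVal (N : Network ι) (A : Set E3) (u : smoothFun ι) :
    N.resV A (N.endVal u) = N.trace A u.1 := rfl

lemma resV_endDer (N : Network ι) (A : Set E3) (u : smoothFun ι) :
    N.resV A (N.endDer u) = N.normalDeriv A u := rfl

lemma sum_ends (N : Network ι) (A : Set E3) {M : Type*} [AddCommMonoid M] (F : ι × Bool → M)
    (hF : ∀ e, N.endpt e ∉ A → F e = 0) : ∑ e : N.Ends A, F e.1 = ∑ e, F e := by
  classical
  rw [← Finset.sum_filter_of_ne (p := fun e => N.endpt e ∈ A) (fun e _ he => by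
    by_contra h; exact he (hF e h))]
  exact (Finset.sum_subtype _ (by simp) _).symm

lemma inner_extV (N : Network ι) (A : Set E3) (a : N.V A) (b : EuclideanSpace ℝ (ι × Bool)) :
    ⟪N.extV A a, b⟫_ℝ = ⟪a, N.resV A b⟫_ℝ := by
  rw [euclidean_inner_eq_sum, euclidean_inner_eq_sum]
  rw [← N.sum_ends A _ fun e he => by rw [N.extV_of_notMem a he, mul_zero]]
  exact Finset.sum_congr rfl fun e _ => by rw [N.extV_of_mem a e.2, resV_apply]

lemma resV_extV_self (N : Network ι) (A : Set E3) (a : N.V A) : N.resV A (N.extV A a) = a := by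
  ext e
  rw [resV_apply, N.extV_of_mem a e.2]

lemma resV_extV_of_disjoint (N : Network ι) {A B : Set E3} (h : Disjoint A B) (a : N.V A) :
    N.resV B (N.extV A a) = 0 := by
  ext e
  rw [resV_apply, N.extV_of_notMem a (disjoint_right.1 h e.2)]
  rfl

lemma endpt_mem (N : Network ι) (e : ι × Bool) : N.endpt e ∈ N.P ∪ N.Q := by
  rw [N.endpoints]
  refine mem_iUnion.2 ⟨e.1, ?_⟩
  obtain ⟨i, b⟩ := e
  cases b <;> simp [endpt, endParam]

/-- Membership in `V₂(A)` as a balance condition at each point of `A`. -/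
lemma resV_mem_V₂ (N : Network ι) {A : Set E3} (w : EuclideanSpace ℝ (ι × Bool)) :
    N.resV A w ∈ N.V₂ A ↔ ∀ p ∈ A, ∀ X : E3, ⟪p, X⟫_ℝ = 0 →
      ∑ᶠ e ∈ {e | N.endpt e = p}, ⟪X, N.endNormal e⟫_ℝ * w e = 0 := by
  classical
  have hfin : ∀ (p : E3) (F : ι × Bool → ℝ), ∑ᶠ e ∈ {e | N.endpt e = p}, F e =
      ∑ e, if N.endpt e = p then F e else 0 := fun p F => by
    rw [← Finset.sum_filter]
    exact finsum_mem_eq_sum_of_inter_support_eq _ (by ext; simp)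
  simp only [hfin]
  constructor
  · intro h p hp X hX
    let v : N.V A := WithLp.toLp 2 fun e => if N.endpt e.1 = p then ⟪X, N.endNormal e.1⟫_ℝ else 0
    have hv : v ∈ N.V₁ A := by
      intro q _
      by_cases hq : q = p
      · subst hq
        exact ⟨X, hX, fun e he => by simp [v, he]⟩
      · refine ⟨0, by simp, fun e he => ?_⟩
        have : N.endpt e.1 ≠ p := fun h' => hq (he ▸ h')
        simp [v, this]
    have h0 := Submodule.inner_right_of_mem_orthogonal hv h
    refine Eq.trans ?_ h0
    simp only [euclidean_inner_eq_sum _ (N.resV A w), resV_apply, v]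
    rw [← N.sum_ends A (fun e => if N.endpt e = p then ⟪X, N.endNormal e⟫_ℝ * w e else 0) fun e he => if_neg (by rintro rfl; exact he hp)]
    refine Finset.sum_congr rfl fun e _ => ?_
    split_ifs <;> ring
  · intro h
    rw [V₂, Submodule.mem_orthogonal]
    intro v hv
    choose X hX hX' using hv
    let Y : E3 → E3 := fun p => if hp : p ∈ A then X p hp else 0
    have hY : ∀ p, ⟪p, Y p⟫_ℝ = 0 := fun p => by
      by_cases hp : p ∈ A <;> simp [Y, hp, hX]
    have hY' : ∀ e : N.Ends A, v e = ⟪Y (N.endpt e.1), N.endNormal e.1⟫_ℝ := fun e => by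
      rw [hX' _ e.2 e rfl]; simp [Y, e.2]
    have hY0 : ∀ p, p ∉ A → Y p = 0 := fun p hp => by simp [Y, hp]
    simp only [euclidean_inner_eq_sum v, resV_apply, hY']
    rw [N.sum_ends A (fun e => w e * ⟪Y (N.endpt e), N.endNormal e⟫_ℝ) fun e he => by
      simp [hY0 _ he]]
    rw [← Finset.sum_fiberwise_of_maps_to (s := Finset.univ)
      (t := Finset.univ.image N.endpt) (g := N.endpt)
      (fun e _ => Finset.mem_image_of_mem _ (Finset.mem_univ e))]
    refine Finset.sum_eq_zero fun p _ => ?_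
    by_cases hp : p ∈ A
    · rw [← h p hp (Y p) (hY p), Finset.sum_filter]
      refine Finset.sum_congr rfl fun e _ => ?_
      split_ifs with he
      · rw [he, mul_comm]
      · rfl
    · refine Finset.sum_eq_zero fun e he => ?_
      rw [(Finset.mem_filter.1 he).2, hY0 p hp]
      simp

lemma compatible_iff (N : Network ι) (u : smoothFun ι) :
    N.Compatible u ↔ N.normalDeriv N.P u ∈ N.V₂ N.P := by
  classical
  rw [← resV_endDer, resV_mem_V₂]
  refine forall₄_congr fun p hp X hX => ?_
  have : ∑ e ∈ {e : N.Ends N.P | N.endpt e.1 = p}.toFinite.toFinset,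
      ⟪X, N.endNormal e.1⟫_ℝ * N.normalDeriv N.P u e =
      ∑ᶠ e ∈ {e | N.endpt e = p}, ⟪X, N.endNormal e⟫_ℝ * N.endDer u e := by
    rw [finsum_mem_eq_finite_toFinset_sum _ (toFinite {e | N.endpt e = p})]
    refine Finset.sum_bij (fun e _ => e.1) (by simp) (fun _ _ _ _ h => Subtype.ext h)
      (fun e he => ?_) (fun _ _ => rfl)
    have he' : N.endpt e = p := by simpa using he
    exact ⟨⟨e, by rw [he']; exact hp⟩, by simpa using he', rfl⟩
  rw [this]

/-- The admissible Dirichlet data: zero on `Q` and in `V₁(P)` on `P`. -/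
def admissible (N : Network ι) : Submodule ℝ (EuclideanSpace ℝ (ι × Bool)) :=
  LinearMap.ker (N.resV N.Q) ⊓ (N.V₁ N.P).comap (N.resV N.P)

lemma mem_admissible {N : Network ι} {a : EuclideanSpace ℝ (ι × Bool)} :
    a ∈ N.admissible ↔ N.resV N.Q a = 0 ∧ N.resV N.P a ∈ N.V₁ N.P := Iff.rfl

lemma mem_admissible_orthogonal {N : Network ι} {b : EuclideanSpace ℝ (ι × Bool)} :
    b ∈ N.admissibleᗮ ↔ N.resV N.P b ∈ N.V₂ N.P := by
  rw [V₂, Submodule.mem_orthogonal, Submodule.mem_orthogonal]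
  constructor
  · intro h v hv
    rw [← inner_extV]
    refine h _ (mem_admissible.2 ⟨N.resV_extV_of_disjoint N.disjoint v, ?_⟩)
    rwa [resV_extV_self]
  · intro h a ha
    rw [← h _ ha.2, ← inner_extV]
    congr 1
    ext e
    by_cases he : N.endpt e ∈ N.P
    · rw [N.extV_of_mem _ he, resV_apply]
    · rw [N.extV_of_notMem _ he]
      have : N.resV N.Q a ⟨e, (N.endpt_mem e).resolve_left he⟩ = 0 := by
        rw [show N.resV N.Q a = 0 from ha.1]; rfl
      exact this

/-- Null functions are the solutions with admissible Dirichlet data and Neumann data orthogonal to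
all admissible data. -/
lemma mem_nullFun {N : Network ι} {d : ι → C(I, ℝ)} {u : smoothFun ι} :
    u ∈ N.nullFun d ↔ N.IsLNull d u ∧ N.endVal u ∈ N.admissible ∧ N.endDer u ∈ N.admissibleᗮ := by
  rw [mem_admissible_orthogonal, mem_admissible, and_assoc]
  exact and_congr_right fun _ => and_congr_right fun _ => and_congr_right fun _ =>
    N.compatible_iff u

/-- The boundary conditions of an `L`-harmonic extension of `g`, in terms of admissible data. -/
lemma endVal_sub_extV_mem {N : Network ι} {A : Set E3} (hA : A ⊆ N.Q) {g : N.V A}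
    {u : smoothFun ι} :
    N.endVal u - N.extV A g ∈ N.admissible ↔
      N.trace N.P u.1 ∈ N.V₁ N.P ∧ N.trace A u.1 = g ∧ N.trace (N.Q \ A) u.1 = 0 := by
  rw [mem_admissible, map_sub, map_sub, resV_endVal, resV_endVal,
    N.resV_extV_of_disjoint (N.disjoint.symm.mono_left hA), sub_zero, and_comm]
  refine and_congr_right fun _ => ⟨fun h => ⟨?_, ?_⟩, ?_⟩
  · ext e
    have h1 := congrArg (fun v : N.V N.Q => v ⟨e.1, hA e.2⟩) h
    have h2 := N.extV_of_mem g e.2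
    simp only [PiLp.sub_apply, resV_apply, PiLp.zero_apply, h2, sub_eq_zero] at h1
    exact h1
  · ext e
    have h1 := congrArg (fun v : N.V N.Q => v ⟨e.1, e.2.1⟩) h
    have h2 := N.extV_of_notMem g e.2.2
    simp only [PiLp.sub_apply, resV_apply, PiLp.zero_apply, h2, sub_zero] at h1
    exact h1
  · rintro ⟨h1, h2⟩
    ext e
    rw [PiLp.sub_apply, resV_apply, PiLp.zero_apply, sub_eq_zero]
    by_cases he : N.endpt e.1 ∈ A
    · rw [N.extV_of_mem g he, ← h1]
      rfl
    · rw [N.extV_of_notMem g he]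
      exact congrArg (fun v : N.V (N.Q \ A) => v ⟨e.1, e.2, he⟩) h2

/-! ### The Fredholm alternative -/

/-- The Cauchy data of solutions of `L u = 0` form a maximal isotropic space: data whose boundary
pairing with all solutions vanishes are themselves the data of a solution. -/
lemma exists_isLNull_of_pairing (N : Network ι) {d : ι → C(I, ℝ)} (hd : d ∈ smoothFun ι)
    {a b : EuclideanSpace ℝ (ι × Bool)}
    (h : ∀ v, N.IsLNull d v → ⟪a, N.endDer v⟫_ℝ = ⟪b, N.endVal v⟫_ℝ) :
    ∃ u, N.IsLNull d u ∧ N.endVal u = a ∧ N.endDer u = b := by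
  -- match the data at the initial ends, then test with solutions prescribed at the final ends
  obtain ⟨u, hu, hu'⟩ := N.exists_isLNull hd false (fun i => a (i, false)) fun i => b (i, false)
  obtain ⟨v, hv, hv'⟩ := N.exists_isLNull hd true
    (fun i => -(b (i, true) - N.endDer u (i, true))) fun i => a (i, true) - N.endVal u (i, true)
  have h1 := h v hv
  have h2 := hu.inner_endVal_endDer hv
  have h3 : ⟪a - N.endVal u, N.endDer v⟫_ℝ - ⟪b - N.endDer u, N.endVal v⟫_ℝ = 0 := by
    rw [inner_sub_left, inner_sub_left, h1, h2]; ring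
  simp only [euclidean_inner_eq_sum, PiLp.sub_apply,
    Fintype.sum_prod_type, Fintype.sum_bool, ← Finset.sum_sub_distrib, hv', hu', sub_self,
    mul_zero, add_zero] at h3
  have hx := fun i => mul_self_nonneg (a (i, true) - N.endVal u (i, true))
  have hy := fun i => mul_self_nonneg (b (i, true) - N.endDer u (i, true))
  have h4 := (Finset.sum_eq_zero_iff_of_nonneg (fun i _ => by linarith [hx i, hy i])).1 h3
  have h5 : ∀ i, a (i, true) - N.endVal u (i, true) = 0 ∧
      b (i, true) - N.endDer u (i, true) = 0 := fun i => by
    have := h4 i (Finset.mem_univ i)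
    exact ⟨mul_self_eq_zero.1 (by linarith [hx i, hy i]),
      mul_self_eq_zero.1 (by linarith [hx i, hy i])⟩
  refine ⟨u, hu, ?_, ?_⟩
  · ext ⟨i, b'⟩
    cases b' with
    | false => exact (hu' i).1
    | true => exact (sub_eq_zero.1 (h5 i).1).symm
  · ext ⟨i, b'⟩
    cases b' with
    | false => exact (hu' i).2
    | true => exact (sub_eq_zero.1 (h5 i).2).symm

/-- The **Fredholm alternative** for the boundary value problem: Dirichlet data `g` are attained
modulo admissible data as soon as they are orthogonal to the Neumann data of all null functions. -/
lemma exists_isLNull_endVal_sub_mem (N : Network ι) {d : ι → C(I, ℝ)} (hd : d ∈ smoothFun ι)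
    {g : EuclideanSpace ℝ (ι × Bool)} (hg : ∀ v ∈ N.nullFun d, ⟪g, N.endDer v⟫_ℝ = 0) :
    ∃ u, N.IsLNull d u ∧ N.endVal u - g ∈ N.admissible ∧ N.endDer u ∈ N.admissibleᗮ := by
  let K := N.admissible
  -- the obstruction to the boundary conditions; its range is its own double orthogonal complement
  let Φ : smoothFun ι →ₗ[ℝ] EuclideanSpace ℝ (ι × Bool) :=
    Kᗮ.starProjection.toLinearMap ∘ₗ N.endVal + K.starProjection.toLinearMap ∘ₗ N.endDer
  have hmem : Kᗮ.starProjection g ∈ (N.solSpace d).map Φ := by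
    rw [← Submodule.orthogonal_orthogonal ((N.solSpace d).map Φ), Submodule.mem_orthogonal]
    intro z hz
    have hz' : ∀ u, N.IsLNull d u →
        ⟪K.starProjection z, N.endDer u⟫_ℝ = ⟪-Kᗮ.starProjection z, N.endVal u⟫_ℝ := by
      intro u hu
      have := Submodule.inner_left_of_mem_orthogonal (Submodule.mem_map_of_mem (f := Φ)
        (mem_solSpace.2 hu)) hz
      simp only [Φ, LinearMap.add_apply, LinearMap.comp_apply, ContinuousLinearMap.coe_coe,
        inner_add_right] at this
      rw [inner_neg_left, Submodule.inner_starProjection_left_eq_right,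
        Submodule.inner_starProjection_left_eq_right]
      linarith
    obtain ⟨v, hv, hv1, hv2⟩ := N.exists_isLNull_of_pairing hd hz'
    have hvJ : v ∈ N.nullFun d := mem_nullFun.2 ⟨hv, hv1 ▸ Submodule.starProjection_apply_mem _ _,
      hv2 ▸ neg_mem (Submodule.starProjection_apply_mem _ _)⟩
    have := hg v hvJ
    rw [hv2, inner_neg_right, neg_eq_zero, real_inner_comm] at this
    rw [← Submodule.inner_starProjection_left_eq_right]
    exact this
  obtain ⟨u, hu, hu'⟩ := hmem
  have h1 : Kᗮ.starProjection (N.endVal u - g) = -K.starProjection (N.endDer u) := by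
    rw [map_sub, ← hu']
    simp only [Φ, LinearMap.add_apply, LinearMap.comp_apply, ContinuousLinearMap.coe_coe]
    abel
  have h2 : K.starProjection (N.endDer u) = 0 := by
    have m1 : K.starProjection (N.endDer u) ∈ K := Submodule.starProjection_apply_mem _ _
    have m2 : K.starProjection (N.endDer u) ∈ Kᗮ := by
      rw [← neg_mem_iff, ← h1]
      exact Submodule.starProjection_apply_mem _ _
    exact (Submodule.disjoint_def.1 K.orthogonal_disjoint) _ m1 m2
  rw [h2, neg_zero] at h1
  refine ⟨u, hu, ?_, ?_⟩
  · have := (Submodule.starProjection_apply_eq_zero_iff (K := Kᗮ)).1 h1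
    rwa [Submodule.orthogonal_orthogonal] at this
  · exact (Submodule.starProjection_apply_eq_zero_iff (K := K)).1 h2

/-! ### The Dirichlet-to-Neumann map -/

/-- The Dirichlet data of a solution that satisfies the interior boundary conditions and vanishes
off `A` are orthogonal to the Neumann data of the null functions. -/
lemma trace_mem_neumannNull_orthogonal {N : Network ι} {d : ι → C(I, ℝ)} {A : Set E3}
    {u : smoothFun ι} (hu : N.IsLNull d u)
    (hV : N.endVal u - N.extV A (N.trace A u.1) ∈ N.admissible) (hC : N.endDer u ∈ N.admissibleᗮ) :
    N.trace A u.1 ∈ (N.neumannNull d A)ᗮ := by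
  rw [Submodule.mem_orthogonal']
  rintro _ ⟨v, hv, rfl⟩
  obtain ⟨hv0, hv1, hv2⟩ := mem_nullFun.1 hv
  rw [← resV_endDer, ← inner_extV]
  have h1 := Submodule.inner_right_of_mem_orthogonal hV hv2
  have h2 := Submodule.inner_left_of_mem_orthogonal hv1 hC
  rw [inner_sub_left, hu.inner_endVal_endDer hv0, h2] at h1
  linarith

lemma isLExtension_iff {N : Network ι} {d : ι → C(I, ℝ)} {A : Set E3} (hA : A ⊆ N.Q)
    {g : N.V A} {u : smoothFun ι} :
    N.IsLExtension d A g u ↔ N.IsLNull d u ∧ N.endVal u - N.extV A g ∈ N.admissible ∧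
      N.endDer u ∈ N.admissibleᗮ ∧ N.normalDeriv A u ∈ (N.neumannNull d A)ᗮ := by
  rw [endVal_sub_extV_mem hA, mem_admissible_orthogonal, resV_endDer, ← compatible_iff,
    IsLExtension]
  tauto

lemma exists_isLExtension (N : Network ι) {d : ι → C(I, ℝ)} (hd : d ∈ smoothFun ι) {A : Set E3}
    (hA : A ⊆ N.Q) (g : (N.neumannNull d A)ᗮ) : ∃ u, N.IsLExtension d A g u := by
  obtain ⟨u, hu, hu1, hu2⟩ := N.exists_isLNull_endVal_sub_mem hd (g := N.extV A g) fun v hv => by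
    rw [inner_extV]
    exact Submodule.inner_left_of_mem_orthogonal
      (Submodule.mem_map_of_mem (f := N.normalDeriv A) hv) g.2
  -- subtract a null function to make the Neumann data orthogonal to `D`
  obtain ⟨w, hw, hw'⟩ : (N.neumannNull d A).starProjection (N.normalDeriv A u) ∈
    N.neumannNull d A := Submodule.starProjection_apply_mem _ _
  obtain ⟨hw0, hw1, hw2⟩ := mem_nullFun.1 hw
  refine ⟨u - w, (isLExtension_iff hA).2 ⟨(N.solSpace d).sub_mem hu hw0, ?_, ?_, ?_⟩⟩
  · rw [map_sub, sub_right_comm]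
    exact sub_mem hu1 hw1
  · rw [map_sub]
    exact sub_mem hu2 hw2
  · rw [map_sub, hw']
    exact Submodule.sub_starProjection_mem_orthogonal _

lemma IsLExtension.sub_mem_nullFun {N : Network ι} {d : ι → C(I, ℝ)} {A : Set E3} (hA : A ⊆ N.Q)
    {g : N.V A} {u v : smoothFun ι} (hu : N.IsLExtension d A g u) (hv0 : N.IsLNull d v)
    (hv1 : N.endVal v - N.extV A g ∈ N.admissible) (hv2 : N.endDer v ∈ N.admissibleᗮ) :
    v - u ∈ N.nullFun d := by
  obtain ⟨hu0, hu1, hu2, -⟩ := (isLExtension_iff hA).1 hu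
  refine mem_nullFun.2 ⟨(N.solSpace d).sub_mem hv0 hu0, ?_, ?_⟩
  · have := sub_mem hv1 hu1
    rwa [sub_sub_sub_cancel_right, ← map_sub] at this
  · rw [map_sub]
    exact sub_mem hv2 hu2

lemma IsLExtension.normalDeriv_eq {N : Network ι} {d : ι → C(I, ℝ)} {A : Set E3} (hA : A ⊆ N.Q)
    {g : N.V A} {u v : smoothFun ι} (hu : N.IsLExtension d A g u) (hv : N.IsLExtension d A g v) :
    N.normalDeriv A u = N.normalDeriv A v := by
  obtain ⟨hv0, hv1, hv2, hv3⟩ := (isLExtension_iff hA).1 hv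
  have h := hu.sub_mem_nullFun hA hv0 hv1 hv2
  have h1 : N.normalDeriv A (v - u) ∈ N.neumannNull d A := ⟨_, h, rfl⟩
  have h2 : N.normalDeriv A (v - u) ∈ (N.neumannNull d A)ᗮ := by
    rw [map_sub]
    exact sub_mem hv3 hu.2.2.2.2.2
  have := (Submodule.disjoint_def.1 (N.neumannNull d A).orthogonal_disjoint) _ h1 h2
  rw [map_sub, sub_eq_zero] at this
  exact this.symm

/-- The Dirichlet-to-Neumann map is well defined. -/
lemma isDtN_dtN (N : Network ι) {d : ι → C(I, ℝ)} (hd : d ∈ smoothFun ι) {A : Set E3}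
    (hA : A ⊆ N.Q) : N.IsDtN d A (N.dtN d A) := by
  suffices h : ∃ T, N.IsDtN d A T by
    rw [dtN, dif_pos h]
    exact h.choose_spec
  choose E hE using N.exists_isLExtension hd hA
  have hE' := fun g => (isLExtension_iff hA).1 (hE g)
  refine ⟨{ toFun := fun g => ⟨N.normalDeriv A (E g), (hE g).2.2.2.2.2⟩
            map_add' := fun g h => Subtype.ext ?_
            map_smul' := fun c g => Subtype.ext ?_ }, fun g => ⟨⟨_, hE g⟩, fun u hu =>
    (hE g).normalDeriv_eq hA hu⟩⟩
  · change N.normalDeriv A (E (g + h)) = N.normalDeriv A (E g) + N.normalDeriv A (E h)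
    rw [← map_add]
    refine (hE (g + h)).normalDeriv_eq hA ((isLExtension_iff hA).2
      ⟨(N.solSpace d).add_mem (hE' g).1 (hE' h).1, ?_, ?_, ?_⟩)
    · rw [Submodule.coe_add, map_add, map_add, add_sub_add_comm]
      exact add_mem (hE' g).2.1 (hE' h).2.1
    · rw [map_add]
      exact add_mem (hE' g).2.2.1 (hE' h).2.2.1
    · rw [map_add]
      exact add_mem (hE' g).2.2.2 (hE' h).2.2.2
  · change N.normalDeriv A (E (c • g)) = c • N.normalDeriv A (E g)
    rw [← map_smul]
    refine (hE (c • g)).normalDeriv_eq hA ((isLExtension_iff hA).2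
      ⟨(N.solSpace d).smul_mem c (hE' g).1, ?_, ?_, ?_⟩)
    · rw [Submodule.coe_smul, map_smul, map_smul, ← smul_sub]
      exact Submodule.smul_mem _ c (hE' g).2.1
    · rw [map_smul]
      exact Submodule.smul_mem _ c (hE' g).2.2.1
    · rw [map_smul]
      exact Submodule.smul_mem _ c (hE' g).2.2.2

/-! ### Regularity of the null space of the index form -/

lemma mem_sobolev₀₁_of_smooth {N : Network ι} {u : smoothFun ι} :
    u.1 ∈ N.sobolev₀₁ ↔ N.endVal u ∈ N.admissible :=
  ⟨fun h => mem_admissible.2 ⟨h.1.2, h.2⟩, fun h => ⟨⟨smoothFun_le_sobolev u.2, h.1⟩, h.2⟩⟩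

/-- By Green's formula the index form of a null function with a function in `W^{1,2}_{0,1}` is the
pairing of Neumann data orthogonal to the admissible data with admissible data. -/
lemma coe_mem_nullSpace_of_mem_nullFun {N : Network ι} {d : ι → C(I, ℝ)} {u : smoothFun ι}
    (hu : u ∈ N.nullFun d) : u.1 ∈ N.nullSpace d := by
  obtain ⟨h0, h1, h2⟩ := mem_nullFun.1 hu
  refine ⟨mem_sobolev₀₁_of_smooth.2 h1, fun v hv => ?_⟩
  rw [indexForm_comm, h0.indexForm_eq hv.1.1]
  have hv' : (WithLp.toLp 2 fun e => v e.1 (endParam e.2) : EuclideanSpace ℝ (ι × Bool)) ∈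
    N.admissible := mem_admissible.2 ⟨hv.1.2, hv.2⟩
  have := Submodule.inner_right_of_mem_orthogonal hv' h2
  rw [euclidean_inner_eq_sum] at this
  simpa only [mul_comm] using this

/-- Arbitrary end values are attained by a smooth function which is affine in the parameter of each
curve. -/
lemma exists_smooth_endVal (N : Network ι) (a : EuclideanSpace ℝ (ι × Bool)) :
    ∃ v, N.endVal v = a := by
  let f : ι → ℝ → ℝ := fun i t => a (i, false) + t * (a (i, true) - a (i, false))
  have hf : ∀ i, ContDiff ℝ ∞ (f i) := fun i =>
    contDiff_const.add (contDiff_id.mul contDiff_const)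
  let v : ι → C(I, ℝ) := fun i => ⟨fun t => f i t, (hf i).continuous.comp continuous_subtype_val⟩
  refine ⟨⟨v, fun i => (hf i).contDiffOn.congr fun t ht => ext_of_mem _ ht⟩, ?_⟩
  ext ⟨i, b⟩
  rw [endVal_apply]
  cases b <;> simp [v, f, endParam]

/-- On each curve, a function in the null space of the index form satisfies `L u = 0` weakly, and
hence classically: its weak arc length derivative agrees almost everywhere with a primitive of
`-d u`, so that `u` and this primitive solve the first order system. -/
lemma exists_isLinearSol_of_mem_nullSpace {N : Network ι} {d : ι → C(I, ℝ)} {u : ι → C(I, ℝ)}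
    (hu : u ∈ N.nullSpace d) (i : ι) :
    ∃ p, IsLinearSol (speed (N.γ i)) (fun t => -(speed (N.γ i) t * ext (d i) t)) (ext (u i)) p := by
  classical
  have hI : uIcc (0 : ℝ) 1 = Icc 0 1 := uIcc_of_le zero_le_one
  have hs := (N.speed_contDiffOn i).continuousOn
  have hs0 : ∀ t ∈ Icc (0 : ℝ) 1, speed (N.γ i) t ≠ 0 := fun t ht => N.speed_ne_zero i ht
  have hW : MemW12 (u i) := hu.1.1.1 i
  have hw := intervalIntegrable_of_memLp (weakDeriv_memLp hW)
  have hq : ContinuousOn (fun t => -(speed (N.γ i) t * ext (d i) t) * ext (u i) t) (Icc 0 1) :=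
    (hs.mul (ext_continuous _).continuousOn).neg.mul (ext_continuous _).continuousOn
  have hp : IntervalIntegrable (fun t => weakDeriv (u i) t / speed (N.γ i) t) volume 0 1 := by
    simp only [div_eq_mul_inv]
    exact hw.mul_continuousOn (hI ▸ hs.inv₀ hs0)
  have hqi := (hI.symm ▸ hq).intervalIntegrable (μ := volume)
  have hweak : IsWeakDeriv (fun t => weakDeriv (u i) t / speed (N.γ i) t)
      (fun t => -(speed (N.γ i) t * ext (d i) t) * ext (u i) t) := by
    intro φ hφ hc hφs
    have hd : Continuous (deriv φ) := hφ.continuous_deriv (by simp)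
    have hφ0 : ∀ b : Bool, φ (endParam b) = 0 := fun b =>
      image_eq_zero_of_notMem_tsupport fun h' => by
        have := hφs h'
        cases b <;> simp [endParam] at this
    -- the test function on the network supported in the `i`-th curve
    let ψ : C(I, ℝ) := ⟨fun t => φ t, hφ.continuous.comp continuous_subtype_val⟩
    have hψ : EqOn (ext ψ) φ (Icc 0 1) := fun t ht => ext_of_mem _ ht
    have hv : Pi.single i ψ ∈ smoothFun ι := fun j => by
      by_cases hj : j = i
      · subst hj
        rw [Pi.single_eq_same]
        exact hφ.contDiffOn.congr hψ
      · rw [Pi.single_eq_of_ne hj]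
        exact (smoothFun ι).zero_mem j
    have hv0 : N.endVal ⟨_, hv⟩ = 0 := by
      ext ⟨j, b⟩
      rw [endVal_apply]
      by_cases hj : j = i
      · subst hj
        change (Pi.single j ψ : ι → C(I, ℝ)) j (endParam b) = 0
        rw [Pi.single_eq_same]
        exact hφ0 b
      · simp [hj]
    have h := hu.2 _ ((mem_sobolev₀₁_of_smooth (u := ⟨_, hv⟩)).2 (hv0 ▸ zero_mem _))
    rw [N.indexForm_smooth d u hv, Finset.sum_eq_single i (fun j _ hj => by
      simp [Pi.single_eq_of_ne hj, ext_zero, der]) (by simp), Pi.single_eq_same] at h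
    have i1 : IntervalIntegrable (fun t => weakDeriv (u i) t / speed (N.γ i) t * deriv φ t)
      volume 0 1 := hp.mul_continuousOn hd.continuousOn
    have i2 : IntervalIntegrable (fun t =>
        -(speed (N.γ i) t * ext (d i) t) * ext (u i) t * φ t) volume 0 1 :=
      hqi.mul_continuousOn hφ.continuous.continuousOn
    rw [← add_eq_zero_iff_eq_neg, ← intervalIntegral.integral_add i1 i2]
    refine Eq.trans (intervalIntegral.integral_congr fun t ht => ?_) h
    rw [hI] at ht
    have hder : der (ext ψ) t = deriv φ t := by
      rw [der, derivWithin_congr hψ (hψ ht)]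
      exact (hφ.differentiable (by simp) t).derivWithin (uIcc01 t ht)
    simp only [hder, hψ ht]
    ring
  obtain ⟨c, hc⟩ := hweak.ae_eq_primitive hp hqi
  let p : ℝ → ℝ := fun t => c + ∫ s in (0 : ℝ)..t, -(speed (N.γ i) s * ext (d i) s) * ext (u i) s
  have hpd : ∀ t ∈ Icc (0 : ℝ) 1, HasDerivWithinAt p
      (-(speed (N.γ i) t * ext (d i) t) * ext (u i) t) (Icc 0 1) t := fun t ht =>
    hasDerivWithinAt_primitive hq c ht
  have hsp : ContinuousOn (fun t => speed (N.γ i) t * p t) (Icc 0 1) :=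
    hs.mul fun t ht => (hpd t ht).continuousWithinAt
  have hprim : ∀ t ∈ Icc (0 : ℝ) 1, ext (u i) t =
      ext (u i) 0 + ∫ s in (0 : ℝ)..t, speed (N.γ i) s * p s := by
    intro t ht
    rw [(weakDeriv_spec hW).eq_primitive (ext_continuous _).continuousOn hw ht]
    congr 1
    refine intervalIntegral.integral_congr_ae_restrict ?_
    rw [uIoc_of_le ht.1]
    filter_upwards [ae_restrict_of_ae_restrict_of_subset (Ioc_subset_Ioc_right ht.2) hc,
      ae_restrict_mem measurableSet_Ioc] with s hs1 hs2
    rw [div_eq_iff (hs0 s ⟨hs2.1.le, hs2.2.trans ht.2⟩)] at hs1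
    rw [hs1, mul_comm]
  refine ⟨p, fun t ht => ⟨?_, hpd t ht⟩⟩
  exact (hasDerivWithinAt_primitive hsp (ext (u i) 0) ht).congr hprim (hprim t ht)

/-- The null space of the index form consists of the null functions. -/
lemma nullSpace_eq_map (N : Network ι) {d : ι → C(I, ℝ)} (hd : d ∈ smoothFun ι) :
    N.nullSpace d = (N.nullFun d).map (smoothFun ι).subtype := by
  ext u
  constructor
  · intro hu
    choose p hp using exists_isLinearSol_of_mem_nullSpace hu
    obtain ⟨hus, hL, -⟩ := N.exists_isLNull_of_isLinearSol hd hp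
    refine ⟨⟨u, hus⟩, mem_nullFun.2 ⟨hL, mem_sobolev₀₁_of_smooth.1 hu.1, ?_⟩, rfl⟩
    rw [Submodule.mem_orthogonal]
    intro a ha
    obtain ⟨v, rfl⟩ := N.exists_smooth_endVal a
    have h1 := hL.indexForm_eq (smoothFun_le_sobolev v.2)
    rw [indexForm_comm, hu.2 v.1 (mem_sobolev₀₁_of_smooth.2 ha)] at h1
    rw [euclidean_inner_eq_sum, h1]
    exact Finset.sum_congr rfl fun e _ => mul_comm _ _
  · rintro ⟨w, hw, rfl⟩
    exact coe_mem_nullSpace_of_mem_nullFun hw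

lemma nullFun_le_solSpace (N : Network ι) (d : ι → C(I, ℝ)) : N.nullFun d ≤ N.solSpace d :=
  fun _ hu => hu.1

instance (N : Network ι) (d : ι → C(I, ℝ)) : FiniteDimensional ℝ (N.nullFun d) :=
  Submodule.finiteDimensional_of_le (N.nullFun_le_solSpace d)

instance (N : Network ι) (d : ι → C(I, ℝ)) (A : Set E3) :
    FiniteDimensional ℝ (N.I₀ d A) :=
  Submodule.finiteDimensional_of_le (S₂ := N.nullFun d) inf_le_left

lemma finiteDimensional_nullSpace (N : Network ι) {d : ι → C(I, ℝ)} (hd : d ∈ smoothFun ι) :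
    FiniteDimensional ℝ (N.nullSpace d) := by
  rw [nullSpace_eq_map N hd]
  infer_instance

lemma nullity_eq (N : Network ι) {d : ι → C(I, ℝ)} (hd : d ∈ smoothFun ι) :
    N.nullity d = Module.finrank ℝ (N.nullFun d) := by
  rw [nullity, nullSpace_eq_map N hd]
  exact Submodule.finrank_map_subtype_eq _ _

/-! ### Null functions relative to a part of the boundary -/

/-- The solutions of `L u = 0` which satisfy all the boundary conditions of a null function except
at the boundary points in `A`, where nothing is prescribed. -/
def relNullFun (N : Network ι) (d : ι → C(I, ℝ)) (A : Set E3) : Submodule ℝ (smoothFun ι) :=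
  N.solSpace d ⊓ N.admissible.comap (N.endVal - N.extV A ∘ₗ N.resV A ∘ₗ N.endVal) ⊓
    N.admissibleᗮ.comap N.endDer

lemma mem_relNullFun {N : Network ι} {d : ι → C(I, ℝ)} {A : Set E3} {u : smoothFun ι} :
    u ∈ N.relNullFun d A ↔ N.IsLNull d u ∧
      N.endVal u - N.extV A (N.trace A u.1) ∈ N.admissible ∧ N.endDer u ∈ N.admissibleᗮ :=
  and_assoc

lemma mem_nullFun_iff_relNullFun {N : Network ι} {d : ι → C(I, ℝ)} {A : Set E3} (hA : A ⊆ N.Q)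
    {u : smoothFun ι} : u ∈ N.nullFun d ↔ u ∈ N.relNullFun d A ∧ N.trace A u.1 = 0 := by
  rw [mem_nullFun, mem_relNullFun]
  constructor
  · rintro ⟨h0, h1, h2⟩
    have h := (endVal_sub_extV_mem hA (g := 0) (u := u)).1 (by rwa [map_zero, sub_zero])
    exact ⟨⟨h0, by rwa [h.2.1, map_zero, sub_zero], h2⟩, h.2.1⟩
  · rintro ⟨⟨h0, h1, h2⟩, h3⟩
    rw [h3, map_zero, sub_zero] at h1
    exact ⟨h0, h1, h2⟩

lemma isLExtension_iff_relNullFun {N : Network ι} {d : ι → C(I, ℝ)} {A : Set E3} (hA : A ⊆ N.Q)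
    {g : N.V A} {u : smoothFun ι} : N.IsLExtension d A g u ↔
      u ∈ N.relNullFun d A ∧ N.trace A u.1 = g ∧ N.normalDeriv A u ∈ (N.neumannNull d A)ᗮ := by
  rw [isLExtension_iff hA, mem_relNullFun]
  constructor
  · rintro ⟨h0, h1, h2, h3⟩
    have h := ((endVal_sub_extV_mem hA).1 h1).2.1
    exact ⟨⟨h0, by rwa [h], h2⟩, h, h3⟩
  · rintro ⟨⟨h0, h1, h2⟩, rfl, h3⟩
    exact ⟨h0, h1, h2, h3⟩

lemma resV_mem_V₁ (N : Network ι) {A : Set E3} (a : EuclideanSpace ℝ (ι × Bool)) :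
    N.resV A a ∈ N.V₁ A ↔ ∀ p ∈ A, ∃ X : E3, ⟪p, X⟫_ℝ = 0 ∧
      ∀ e, N.endpt e = p → a e = ⟪X, N.endNormal e⟫_ℝ :=
  forall₂_congr fun _ hp => exists_congr fun _ => and_congr_right fun _ =>
    ⟨fun h e he => h ⟨e, he ▸ hp⟩ he, fun h e he => h e.1 he⟩

end Network

/-! ### Dimensions of subspaces -/

/-- The rank-nullity theorem for the restriction of a linear map to a finite dimensional
subspace. -/
lemma finrank_map_add_finrank_inf_ker {V W : Type*} [AddCommGroup V] [Module ℝ V]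
    [AddCommGroup W] [Module ℝ W] (f : V →ₗ[ℝ] W) (J : Submodule ℝ V) [FiniteDimensional ℝ J] :
    Module.finrank ℝ (J.map f) + Module.finrank ℝ ((J ⊓ LinearMap.ker f : Submodule ℝ V)) =
      Module.finrank ℝ J := by
  have h := LinearMap.finrank_range_add_finrank_ker (f.domRestrict J)
  rw [LinearMap.range_domRestrict] at h
  rw [← h, ← Submodule.finrank_map_subtype_eq J (LinearMap.ker (f.domRestrict J)),
    LinearMap.ker_domRestrict, Submodule.map_comap_subtype]

lemma finrank_pi_submodule {κ : Type*} [Fintype κ] {V : κ → Type*} [∀ k, AddCommGroup (V k)]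
    [∀ k, Module ℝ (V k)] (p : ∀ k, Submodule ℝ (V k)) [∀ k, FiniteDimensional ℝ (p k)] :
    Module.finrank ℝ (∀ k, p k) = ∑ k, Module.finrank ℝ (p k) :=
  Module.finrank_pi_fintype ℝ

namespace Partition

open Network

variable {N : Network ι} {l : ℕ} (S : Partition N l)

/-! ### Functions and boundary data on the parts of a partition -/

/-- A smooth function on the network is the same as a family of smooth functions on the parts. -/
def splitFun : smoothFun ι ≃ₗ[ℝ] (∀ k, smoothFun {j : ι // S.block j = k}) where
  toFun u := fun k => ⟨S.restr u.1 k, fun j => u.2 j.1⟩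
  invFun w := ⟨fun j => (w (S.block j)).1 ⟨j, rfl⟩, fun j => (w (S.block j)).2 ⟨j, rfl⟩⟩
  map_add' _ _ := rfl
  map_smul' _ _ := rfl
  left_inv _ := rfl
  right_inv w := by
    ext k ⟨j, rfl⟩ t
    rfl

lemma restr_mem_smoothFun {d : ι → C(I, ℝ)} (hd : d ∈ smoothFun ι) (k : Fin l) :
    S.restr d k ∈ smoothFun _ := fun j => hd j.1

lemma Qcut_subset (k : Fin l) : S.Qcut k ⊆ (S.sub k).Q := by
  rw [S.Qsub_eq]
  exact subset_union_left

lemma P_sub_subset (k : Fin l) : (S.sub k).P ⊆ N.P := by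
  rw [S.P_eq, S.Pin_eq]
  exact (subset_iUnion (fun k => (S.sub k).P) k).trans subset_union_left

lemma Pcut_subset : S.Pcut ⊆ N.P := by
  rw [S.P_eq]
  exact subset_union_right

lemma endDer_splitFun (u : smoothFun ι) (k : Fin l) (j : {j : ι // S.block j = k}) (b : Bool) :
    (S.sub k).endDer (S.splitFun u k) (j, b) = N.endDer u (j.1, b) := by
  rw [endDer_apply, endDer_apply, S.γ_eq]
  rfl

lemma endNormal_sub (k : Fin l) (j : {j : ι // S.block j = k}) (b : Bool) :
    (S.sub k).endNormal (j, b) = N.endNormal (j.1, b) := by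
  simp [endNormal, S.ν_eq]

lemma split_trace (u : smoothFun ι) (k : Fin l) :
    S.split (N.trace S.Pcut u.1) k = (S.sub k).trace (S.Qcut k) (S.splitFun u k).1 := rfl

lemma split_normalDeriv (u : smoothFun ι) (k : Fin l) :
    S.split (N.normalDeriv S.Pcut u) k = (S.sub k).normalDeriv (S.Qcut k) (S.splitFun u k) := by
  ext ⟨⟨j, b⟩, he⟩
  exact (S.endDer_splitFun u k j b).symm

lemma isLNull_iff {d : ι → C(I, ℝ)} {u : smoothFun ι} :
    N.IsLNull d u ↔ ∀ k, (S.sub k).IsLNull (S.restr d k) (S.splitFun u k) := by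
  constructor
  · intro h k j t
    rw [S.γ_eq]
    exact h j.1 t
  · intro h i t
    have := h (S.block i) ⟨i, rfl⟩ t
    rw [S.γ_eq] at this
    exact this

/-- All curves that end at an interior end point of a part belong to this part. -/
lemma block_eq_of_mem_P {k : Fin l} {e : ι × Bool} (h : N.endpt e ∈ (S.sub k).P) :
    S.block e.1 = k := by
  by_contra hne
  have h0 := (S.sub (S.block e.1)).endpt_mem (⟨e.1, rfl⟩, e.2)
  rw [S.endpt_sub, S.Qsub_eq] at h0
  rcases h0 with h0 | h0 | h0
  · exact disjoint_left.1 (S.Pin_disj hne) h0 h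
  · refine disjoint_left.1 S.P_disj ?_ (S.mem_Pcut h0)
    rw [S.Pin_eq]
    exact mem_iUnion.2 ⟨k, h⟩
  · refine disjoint_left.1 N.disjoint (S.P_sub_subset k h) ?_
    rw [S.Q_eq]
    exact mem_iUnion.2 ⟨_, h0⟩

lemma endpt_mem_Q_iff (e : ι × Bool) :
    N.endpt e ∈ N.Q ↔ N.endpt e ∈ (S.sub (S.block e.1)).Q \ S.Qcut (S.block e.1) := by
  constructor
  · intro h
    have h0 := (S.sub (S.block e.1)).endpt_mem (⟨e.1, rfl⟩, e.2)
    rw [S.endpt_sub] at h0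
    refine ⟨h0.resolve_left fun h1 => ?_, fun h1 => ?_⟩
    · exact disjoint_left.1 N.disjoint (S.P_sub_subset _ h1) h
    · exact disjoint_left.1 N.disjoint (S.Pcut_subset (S.mem_Pcut h1)) h
  · rintro ⟨h1, h2⟩
    rw [S.Qsub_eq] at h1
    rw [S.Q_eq]
    exact mem_iUnion.2 ⟨_, h1.resolve_left h2⟩

lemma forall_mem_P_iff {p : E3 → Prop} :
    (∀ x ∈ N.P, p x) ↔ (∀ k, ∀ x ∈ (S.sub k).P, p x) ∧ ∀ x ∈ S.Pcut, p x := by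
  rw [S.P_eq, S.Pin_eq]
  simp only [mem_union, mem_iUnion]
  exact ⟨fun h => ⟨fun k x hx => h x (Or.inl ⟨k, hx⟩), fun x hx => h x (Or.inr hx)⟩,
    fun h x hx => hx.elim (fun ⟨k, hk⟩ => h.1 k x hk) (h.2 x)⟩

lemma trace_P_mem_V₁_iff {u : smoothFun ι} :
    N.trace N.P u.1 ∈ N.V₁ N.P ↔
      (∀ k, (S.sub k).trace (S.sub k).P (S.splitFun u k).1 ∈ (S.sub k).V₁ (S.sub k).P) ∧
        N.trace S.Pcut u.1 ∈ N.V₁ S.Pcut := by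
  simp only [← resV_endVal, resV_mem_V₁]
  rw [S.forall_mem_P_iff]
  refine and_congr_left fun _ => forall_congr' fun k => forall₂_congr fun p hp =>
    exists_congr fun X => and_congr_right fun _ => ⟨?_, ?_⟩
  · rintro h ⟨j, b⟩ he
    rw [S.endpt_sub] at he
    rw [S.endNormal_sub]
    exact h _ he
  · rintro h ⟨j, b⟩ he
    obtain rfl := S.block_eq_of_mem_P (e := (j, b)) (by rw [he]; exact hp)
    have := h (⟨j, rfl⟩, b) (by rw [S.endpt_sub]; exact he)
    rwa [S.endNormal_sub] at this

lemma normalDeriv_P_mem_V₂_iff {u : smoothFun ι} :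
    N.normalDeriv N.P u ∈ N.V₂ N.P ↔
      (∀ k, (S.sub k).normalDeriv (S.sub k).P (S.splitFun u k) ∈ (S.sub k).V₂ (S.sub k).P) ∧
        N.normalDeriv S.Pcut u ∈ N.V₂ S.Pcut := by
  simp only [← resV_endDer, resV_mem_V₂]
  rw [S.forall_mem_P_iff]
  refine and_congr_left fun _ => forall_congr' fun k => forall₂_congr fun p hp =>
    forall₂_congr fun X _ => ?_
  have : ∑ᶠ e ∈ {e | (S.sub k).endpt e = p},
      ⟪X, (S.sub k).endNormal e⟫_ℝ * (S.sub k).endDer (S.splitFun u k) e =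
      ∑ᶠ e ∈ {e | N.endpt e = p}, ⟪X, N.endNormal e⟫_ℝ * N.endDer u e := by
    refine finsum_mem_eq_of_bijOn (fun e => (e.1.1, e.2)) ⟨?_, ?_, ?_⟩ ?_
    · rintro ⟨j, b⟩ he
      exact (S.endpt_sub k j b).symm.trans he
    · rintro ⟨j, b⟩ _ ⟨j', b'⟩ _ h
      rw [Prod.mk.injEq] at h
      exact Prod.ext (Subtype.ext h.1) h.2
    · rintro ⟨j, b⟩ he
      have he' : N.endpt (j, b) = p := he
      obtain rfl := S.block_eq_of_mem_P (e := (j, b)) (by rw [he']; exact hp)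
      exact ⟨(⟨j, rfl⟩, b), (S.endpt_sub _ _ _).trans he', rfl⟩
    · rintro ⟨j, b⟩ _
      rw [S.endNormal_sub, S.endDer_splitFun]
  rw [this]

lemma trace_Q_eq_zero_iff {u : smoothFun ι} :
    N.trace N.Q u.1 = 0 ↔
      ∀ k, (S.sub k).trace ((S.sub k).Q \ S.Qcut k) (S.splitFun u k).1 = 0 := by
  constructor
  · intro h k
    ext ⟨⟨⟨j, rfl⟩, b⟩, he⟩
    rw [S.endpt_sub] at he
    exact congrArg (fun v : N.V N.Q => v ⟨(j, b), (S.endpt_mem_Q_iff (j, b)).2 he⟩) h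
  · intro h
    ext ⟨⟨j, b⟩, he⟩
    exact congrArg (fun v : (S.sub (S.block j)).V _ => v ⟨(⟨j, rfl⟩, b), by
      rw [S.endpt_sub]; exact (S.endpt_mem_Q_iff (j, b)).1 he⟩) (h (S.block j))

/-- A function on the network is a null function if and only if its restrictions are null functions
of the parts relative to the cut points and the transmission conditions hold at the cut points. -/
lemma mem_nullFun_iff {d : ι → C(I, ℝ)} {u : smoothFun ι} :
    u ∈ N.nullFun d ↔
      (∀ k, S.splitFun u k ∈ (S.sub k).relNullFun (S.restr d k) (S.Qcut k)) ∧
        N.trace S.Pcut u.1 ∈ N.V₁ S.Pcut ∧ N.normalDeriv S.Pcut u ∈ N.V₂ S.Pcut := by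
  simp only [mem_relNullFun, endVal_sub_extV_mem (S.Qcut_subset _), mem_admissible_orthogonal,
    resV_endDer, true_and, forall_and, ← S.isLNull_iff, ← S.trace_Q_eq_zero_iff]
  rw [mem_nullFun, mem_admissible, mem_admissible_orthogonal, resV_endVal, resV_endVal,
    resV_endDer, S.trace_P_mem_V₁_iff, S.normalDeriv_P_mem_V₂_iff]
  tauto

/-! ### Direct sums over the parts -/

lemma mem_sum {W : ∀ k, Submodule ℝ ((S.sub k).V (S.Qcut k))} {g : N.V S.Pcut} :
    g ∈ S.sum W ↔ ∀ k, S.split g k ∈ W k :=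
  ⟨fun h k => h k (mem_univ k), fun h k _ => h k⟩

/-- The ends of curves at cut points, sorted by the parts. -/
def endsCutEquiv : N.Ends S.Pcut ≃ Σ k, (S.sub k).Ends (S.Qcut k) where
  toFun e := ⟨S.block e.1.1, (⟨e.1.1, rfl⟩, e.1.2), by rw [S.endpt_sub]; exact S.mem_Qcut e.2⟩
  invFun e := ⟨(e.2.1.1.1, e.2.1.2), S.mem_Pcut (k := e.1) (by
    rw [← S.endpt_sub]; exact e.2.2)⟩
  left_inv _ := rfl
  right_inv := by
    rintro ⟨k, ⟨⟨j, rfl⟩, b⟩, he⟩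
    rfl

lemma inner_eq_sum_split (g h : N.V S.Pcut) :
    ⟪g, h⟫_ℝ = ∑ k, ⟪S.split g k, S.split h k⟫_ℝ := by
  simp only [euclidean_inner_eq_sum]
  rw [← Fintype.sum_sigma']
  exact Fintype.sum_equiv S.endsCutEquiv _ _ fun _ => rfl

lemma sum_orthogonal (W : ∀ k, Submodule ℝ ((S.sub k).V (S.Qcut k))) :
    S.sum (fun k => (W k)ᗮ) = (S.sum W)ᗮ := by
  classical
  ext g
  rw [mem_sum, Submodule.mem_orthogonal]
  constructor
  · intro h f hf
    rw [inner_eq_sum_split]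
    exact Finset.sum_eq_zero fun k _ =>
      Submodule.inner_right_of_mem_orthogonal (S.mem_sum.1 hf k) (h k)
  · intro h k
    rw [Submodule.mem_orthogonal]
    intro v hv
    have := h (S.split.symm (Pi.single k v)) (S.mem_sum.2 fun m => by
      rw [LinearEquiv.apply_symm_apply]
      by_cases hm : m = k
      · subst hm
        rwa [Pi.single_eq_same]
      · rw [Pi.single_eq_of_ne hm]
        exact zero_mem _)
    rw [inner_eq_sum_split, LinearEquiv.apply_symm_apply, Finset.sum_eq_single k
      (fun m _ hm => by rw [Pi.single_eq_of_ne hm, inner_zero_left]) (by simp),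
      Pi.single_eq_same] at this
    exact this

lemma V₁bar_orthogonal (d : ι → C(I, ℝ)) :
    (S.V₁bar d)ᗮ = S.sum (S.D d) ⊔ N.V₂ S.Pcut := by
  rw [V₁bar, sum_orthogonal, ← Submodule.orthogonal_orthogonal (N.V₁ S.Pcut),
    Submodule.inf_orthogonal, Submodule.orthogonal_orthogonal, V₂]

lemma split_That (d : ι → C(I, ℝ)) (g : S.sum fun k => (S.D d k)ᗮ) (k : Fin l) :
    S.split (S.That d g) k =
      (S.sub k).dtN (S.restr d k) (S.Qcut k) ⟨S.split g k, S.mem_sum.1 g.2 k⟩ :=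
  congrFun (S.split.apply_symm_apply _) k

lemma mem_ker_Tbar {d : ι → C(I, ℝ)} {g : S.V₁bar d} :
    g ∈ LinearMap.ker (S.Tbar d) ↔
      (S.That d (Submodule.inclusion inf_le_left g) : N.V S.Pcut) ∈
        S.sum (S.D d) ⊔ N.V₂ S.Pcut := by
  rw [← V₁bar_orthogonal, ← Submodule.orthogonalProjectionOnto_eq_zero_iff]
  exact Iff.rfl

/-! ### The dimension count -/

/-- The trace of null functions at the cut points. -/
def traceCut : smoothFun ι →ₗ[ℝ] N.V S.Pcut := N.trace S.Pcut ∘ₗ (smoothFun ι).subtype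

/-- The traces of the null functions at the cut points form the kernel of `Tbar`. -/
lemma map_traceCut_nullFun {d : ι → C(I, ℝ)} (hd : d ∈ smoothFun ι) :
    (N.nullFun d).map S.traceCut = (LinearMap.ker (S.Tbar d)).map (S.V₁bar d).subtype := by
  have hDtN := fun k => (S.sub k).isDtN_dtN (S.restr_mem_smoothFun hd k) (S.Qcut_subset k)
  ext g
  constructor
  · rintro ⟨u, hu, rfl⟩
    obtain ⟨hrel, hV₁, hV₂⟩ := S.mem_nullFun_iff.1 hu
    have hsum : N.trace S.Pcut u.1 ∈ S.sum fun k => (S.D d k)ᗮ := S.mem_sum.2 fun k => by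
      obtain ⟨h0, h1, h2⟩ := mem_relNullFun.1 (hrel k)
      exact trace_mem_neumannNull_orthogonal h0 h1 h2
    refine ⟨⟨_, hsum, hV₁⟩, S.mem_ker_Tbar.2 ?_, rfl⟩
    -- the Neumann data of `u` differ from those of the extensions by elements of `D`
    rw [← sub_add_cancel (S.That d _ : N.V S.Pcut) (N.normalDeriv S.Pcut u)]
    refine Submodule.add_mem_sup (S.mem_sum.2 fun k => ?_) hV₂
    obtain ⟨⟨v, hv⟩, hT⟩ := hDtN k ⟨_, S.mem_sum.1 hsum k⟩
    obtain ⟨h0, h1, h2⟩ := mem_relNullFun.1 (hrel k)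
    have hsub := hv.sub_mem_nullFun (S.Qcut_subset k) h0 h1 h2
    rw [map_sub, Pi.sub_apply, split_normalDeriv, split_That]
    refine (Submodule.neg_mem_iff _).1 ⟨_, hsub, ?_⟩
    rw [map_sub, neg_sub]
    exact congrArg _ (hT v hv).symm
  · rintro ⟨g, hg, rfl⟩
    obtain ⟨δ, hδ, η, hη, hsum⟩ := Submodule.mem_sup.1 (S.mem_ker_Tbar.1 hg)
    choose w hw hwδ using S.mem_sum.1 hδ
    choose v hv using fun k => (hDtN k ⟨_, S.mem_sum.1 g.2.1 k⟩).1
    have hT := fun k => (hDtN k ⟨_, S.mem_sum.1 g.2.1 k⟩).2 (v k) (hv k)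
    have hv' := fun k => (isLExtension_iff_relNullFun (S.Qcut_subset k)).1 (hv k)
    have hw' := fun k => (mem_nullFun_iff_relNullFun (S.Qcut_subset k)).1 (hw k)
    have htr : N.trace S.Pcut (S.splitFun.symm (v - w)).1 = g.1 := by
      apply S.split.injective
      ext1 k
      rw [split_trace, LinearEquiv.apply_symm_apply]
      simp only [Pi.sub_apply, Submodule.coe_sub, map_sub, (hv' k).2.1, (hw' k).2, sub_zero]
    have hnd : N.normalDeriv S.Pcut (S.splitFun.symm (v - w)) = η := by
      rw [← add_right_inj δ, hsum]
      apply S.split.injective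
      ext1 k
      rw [map_add, Pi.add_apply, split_normalDeriv, LinearEquiv.apply_symm_apply, split_That,
        Pi.sub_apply, map_sub, hwδ k, add_sub_cancel]
      exact (hT k).symm
    refine ⟨S.splitFun.symm (v - w), S.mem_nullFun_iff.2 ⟨fun k => ?_, ?_, ?_⟩, htr⟩
    · rw [LinearEquiv.apply_symm_apply]
      exact sub_mem (hv' k).1 (hw' k).1
    · rw [htr]
      exact g.2.2
    · rwa [hnd]

/-- For functions vanishing at the cut points the transmission condition on the values is void, so
that only the one on the normal derivatives couples the parts. -/
lemma mem_nullFun_inf_ker_traceCut {d : ι → C(I, ℝ)} {u : smoothFun ι} :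
    u ∈ N.nullFun d ⊓ LinearMap.ker S.traceCut ↔
      (∀ k, S.splitFun u k ∈ (S.sub k).nullFun (S.restr d k)) ∧
        N.normalDeriv S.Pcut u ∈ N.V₂ S.Pcut := by
  have h : S.traceCut u = 0 ↔ ∀ k, (S.sub k).trace (S.Qcut k) (S.splitFun u k).1 = 0 := by
    rw [← S.split.map_eq_zero_iff, funext_iff]
    exact Iff.rfl
  rw [Submodule.mem_inf, S.mem_nullFun_iff, LinearMap.mem_ker]
  simp only [mem_nullFun_iff_relNullFun (S.Qcut_subset _), forall_and]
  rw [← h]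
  constructor
  · rintro ⟨⟨h0, -, h2⟩, h3⟩
    exact ⟨⟨h0, h3⟩, h2⟩
  · rintro ⟨⟨h0, h3⟩, h2⟩
    refine ⟨⟨h0, ?_, h2⟩, h3⟩
    rw [show N.trace S.Pcut u.1 = 0 from h3]
    exact zero_mem _

/-- The Neumann data at the cut points of the null functions vanishing there form `F₂`. -/
lemma map_normalDeriv_nullFun_inf (d : ι → C(I, ℝ)) :
    (N.nullFun d ⊓ LinearMap.ker S.traceCut).map (N.normalDeriv S.Pcut) = S.F₂ d := by
  ext g
  constructor
  · rintro ⟨u, hu, rfl⟩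
    obtain ⟨h1, h2⟩ := S.mem_nullFun_inf_ker_traceCut.1 hu
    exact ⟨S.mem_sum.2 fun k => ⟨_, h1 k, (S.split_normalDeriv u k).symm⟩, h2⟩
  · rintro ⟨h1, h2⟩
    choose w hw hwg using S.mem_sum.1 h1
    have hnd : N.normalDeriv S.Pcut (S.splitFun.symm w) = g := by
      apply S.split.injective
      ext1 k
      rw [split_normalDeriv, LinearEquiv.apply_symm_apply, hwg]
    refine ⟨S.splitFun.symm w, S.mem_nullFun_inf_ker_traceCut.2 ⟨fun k => ?_, ?_⟩, hnd⟩
    · rw [LinearEquiv.apply_symm_apply]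
      exact hw k
    · rwa [hnd]

/-- The null functions with vanishing Cauchy data at the cut points are the families of elements
of the spaces `I₀` of the parts. -/
lemma finrank_nullFun_inf_inf (d : ι → C(I, ℝ)) :
    Module.finrank ℝ ((N.nullFun d ⊓ LinearMap.ker S.traceCut ⊓
      LinearMap.ker (N.normalDeriv S.Pcut) : Submodule ℝ (smoothFun ι))) =
      ∑ k, Module.finrank ℝ ((S.sub k).I₀ (S.restr d k) (S.Qcut k)) := by
  let Ψ : (∀ k, (S.sub k).I₀ (S.restr d k) (S.Qcut k)) →ₗ[ℝ] smoothFun ι :=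
    S.splitFun.symm.toLinearMap ∘ₗ
      LinearMap.pi fun k => Submodule.subtype _ ∘ₗ LinearMap.proj k
  have hΨ : ∀ w k, S.splitFun (Ψ w) k = (w k).1 := fun w k => by
    exact congrFun (S.splitFun.apply_symm_apply _) k
  have hinj : Function.Injective Ψ := fun w w' h => by
    ext1 k
    rw [Subtype.ext_iff, ← hΨ, h, hΨ]
  have hnd : ∀ u, N.normalDeriv S.Pcut u = 0 ↔
      ∀ k, (S.sub k).normalDeriv (S.Qcut k) (S.splitFun u k) = 0 := fun u => by
    rw [← S.split.map_eq_zero_iff, funext_iff]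
    exact forall_congr' fun k => by rw [split_normalDeriv]; rfl
  have hrange : LinearMap.range Ψ = N.nullFun d ⊓ LinearMap.ker S.traceCut ⊓
      LinearMap.ker (N.normalDeriv S.Pcut) := by
    ext u
    rw [Submodule.mem_inf, mem_nullFun_inf_ker_traceCut, LinearMap.mem_ker]
    constructor
    · rintro ⟨w, rfl⟩
      have h0 : N.normalDeriv S.Pcut (Ψ w) = 0 := (hnd _).2 fun k => by
        rw [hΨ]
        exact (w k).2.2
      refine ⟨⟨fun k => ?_, h0 ▸ zero_mem _⟩, h0⟩
      rw [hΨ]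
      exact (w k).2.1
    · rintro ⟨⟨h1, -⟩, h2⟩
      refine ⟨fun k => ⟨S.splitFun u k, h1 k, (hnd u).1 h2 k⟩, S.splitFun.injective ?_⟩
      ext1 k
      rw [hΨ]
  rw [← hrange, LinearMap.finrank_range_of_inj hinj]
  exact finrank_pi_submodule _

end Partition

end SphereNetwork

end

theorem mainTheorem3 {ι : Type*} [Fintype ι] (N : SphereNetwork.Network ι) {l : ℕ}
    (S : SphereNetwork.Partition N l) (d : ι → C(unitInterval, ℝ))
    (hd : d ∈ SphereNetwork.smoothFun ι) :
    (∀ k, (S.sub k).IsDtN (S.restr d k) (S.Qcut k)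
      ((S.sub k).dtN (S.restr d k) (S.Qcut k))) ∧
    FiniteDimensional ℝ (N.nullSpace d) ∧
    (∀ k, FiniteDimensional ℝ ((S.sub k).I₀ (S.restr d k) (S.Qcut k))) ∧
    N.nullity d =
      Module.finrank ℝ (LinearMap.ker (S.Tbar d)) + Module.finrank ℝ (S.F₂ d) +
        ∑ k, Module.finrank ℝ ((S.sub k).I₀ (S.restr d k) (S.Qcut k)) := by
  refine ⟨fun k => (S.sub k).isDtN_dtN (S.restr_mem_smoothFun hd k) (S.Qcut_subset k),
    N.finiteDimensional_nullSpace hd, fun k => inferInstance, ?_⟩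
  have h1 := SphereNetwork.finrank_map_add_finrank_inf_ker S.traceCut (N.nullFun d)
  have : FiniteDimensional ℝ
      (N.nullFun d ⊓ LinearMap.ker S.traceCut : Submodule ℝ (SphereNetwork.smoothFun ι)) :=
    Submodule.finiteDimensional_of_le (S₂ := N.nullFun d) inf_le_left
  have h2 := SphereNetwork.finrank_map_add_finrank_inf_ker (N.normalDeriv S.Pcut)
    (N.nullFun d ⊓ LinearMap.ker S.traceCut)
  rw [S.map_normalDeriv_nullFun_inf, S.finrank_nullFun_inf_inf] at h2
  rw [S.map_traceCut_nullFun hd, Submodule.finrank_map_subtype_eq] at h1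
  rw [N.nullity_eq hd, ← h1, ← h2, add_assoc]
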